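/- Let $G$ be a countable discrete group. For a unitary representation $\pi$ of $G$ on a complex Hilbert space $\mathcal H$ and $f\in\mathbf C[G]$ put $\pi(f)=\sum_{s\in G}f(s)\pi(s)$; let $C^*_\pi(G)$ be the norm closure of $\{\pi(f): f\in\mathbf C[G]\}$ in $\mathcal B(\mathcal H)$ and $W^*_\pi(G)$ its closure in the strong operator topology. Irreducible representations are understood to be non-zero. One writes $\rho\prec\pi$ ($\rho$ is weakly contained in $\pi$) if $\|\rho(f)\|\le\|\pi(f)\|$ for all $f\in\mathbf C[G]$ (equivalently, for all elements of the maximal $C^*$-algebra $C^*(G)$), and $\rho\sim\pi$ (weak equivalence) if $\rho\prec\pi$ and $\pi\prec\rho$. A representation $\pi$ such that $W^*_\pi(G)$ is a factor is traceable if there are a faithful normal (not necessarily finite) trace $\tau$ on $W^*_\pi(G)$ and a positive $x\in C^*_\pi(G)$ with $0<\tau(x)<\infty$; for irreducible $\pi$ this means that $C^*_\pi(G)$ contains all compact operators on $\mathcal H$. For a subgroup $H\le G$ and a unitary representation $(\sigma,\mathcal K)$ of $H$, $\operatorname{Ind}_H^G\sigma$ is the representation of $G$ by left translations, $(g\cdot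 F)(x)=F(g^{-1}x)$, on the Hilbert space of maps $F:G\to\mathcal K$ with $F(xh)=\sigma(h^{-1})F(x)$ for $x\in G$, $h\in H$, and $\sum_{x\in G/H}\|F(x)\|^2<\infty$. A subgroup $L\le G$ is self-commensurating if it equals its commensurator $\{g\in G: gLg^{-1}\cap L\text{ has finite index in } L \text{ and in } gLg^{-1}\}$. For $g\in G$ and a representation $\sigma$ of $L$, $\sigma^g$ denotes the representation $x\mapsto\sigma(gxg^{-1})$ of $g^{-1}Lg$. Let $H\le G$ be a subgroup with the spectral gap property: the natural representation of $H$ on $\ell^2(X)$, where $X=(G/H)\setminus\{H\}$, does not weakly contain the trivial representation $1_H$. Then the following hold. (i) For every finite-dimensional irreducible unitary representation $\sigma$ of $H$, the representation $\operatorname{Ind}_H^G\sigma$ is irreducible and traceable, and its $C^*$-algebra $C^*_{\operatorname{Ind}_H^G\sigma}(G)$ contains all compact operators. (ii) Let $\sigma$ be a finite-dimensional irreducible unitary representation of $H$ and $\pi$ an irreducible unitary representation of $G$. If $\pi\sim\operatorname{Ind}_H^G\sigma$, then $\pi$ is unitarily equivalent to $\operatorname{Ind}_H^G\sigma$. (iii)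 Let $L\le G$ be a self-commensurating subgroup, and let $\sigma$ and $\pi$ be finite-dimensional irreducible unitary representations of $L$ and $H$, respectively. If $\operatorname{Ind}_L^G\sigma\sim\operatorname{Ind}_H^G\pi$, then there exists $g\in G$ such that $H=g^{-1}Lg$ and $\pi$ is unitarily equivalent to $\sigma^g$. -/

import Mathlib

open scoped ENNReal InnerProductSpace

universe u v w

noncomputable section

/-- A unitary representation of the discrete group `G` on the inner product space `E`
(a Hilbert space whenever `E` is complete). -/
abbrev UnitaryRep (G : Type u) [Group G] (E : Type v) [NormedAddCommGroup E]
    [InnerProductSpace ℂ E] : Type (max u v) :=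
  G →* (E ≃ₗᵢ[ℂ] E)

namespace UnitaryRep

section General

variable {G : Type u} [Group G]
variable {E : Type v} [NormedAddCommGroup E] [InnerProductSpace ℂ E]
variable {F : Type w} [NormedAddCommGroup F] [InnerProductSpace ℂ F]

/-- The operators `π(g)`, as a homomorphism into the algebra of bounded operators. -/
def toOperators (π : UnitaryRep G E) : G →* (E →L[ℂ] E) where
  toFun g := ((π g).toContinuousLinearEquiv : E →L[ℂ] E)
  map_one' := by
    ext x
    simp
  map_mul' a b := by
    ext x
    simp

@[simp]
theorem toOperators_apply (π : UnitaryRep G E) (g : G) (x : E) :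
    toOperators π g x = π g x := rfl

/-- The extension of `π` to the group algebra `ℂ[G]`: `π(f) = ∑ f(s) π(s)`. -/
def groupAlgebraHom (π : UnitaryRep G E) : MonoidAlgebra ℂ G →ₐ[ℂ] (E →L[ℂ] E) :=
  MonoidAlgebra.lift ℂ (E →L[ℂ] E) G (toOperators π)

/-- The C*-algebra `C*_π(G)`: the norm closure of `{π(f) | f ∈ ℂ[G]}` in `B(E)`. -/
def cstar (π : UnitaryRep G E) : Set (E →L[ℂ] E) :=
  closure (Set.range (groupAlgebraHom π))

/-- The von Neumann algebra `W*_π(G)`: the closure of `C*_π(G)` in `B(E)` for the strong operator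
topology, i.e. the topology of pointwise convergence (the topology induced from the product
topology on `E → E`). -/
def vonNeumann (π : UnitaryRep G E) : Set (E →L[ℂ] E) :=
  {T | (T : E → E) ∈ closure ((fun S : E →L[ℂ] E => (S : E → E)) '' cstar π)}

/-- Irreducibility: the space is non-zero, and the only closed invariant subspaces are the
trivial ones. -/
def IsIrreducible (π : UnitaryRep G E) : Prop :=
  Nontrivial E ∧ ∀ S : Submodule ℂ E, IsClosed (S : Set E) →
    (∀ g : G, ∀ x ∈ S, π g x ∈ S) → S = ⊥ ∨ S = ⊤

/-- Unitary equivalence. -/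
def UnitarilyEquivalent (π : UnitaryRep G E) (ρ : UnitaryRep G F) : Prop :=
  ∃ U : E ≃ₗᵢ[ℂ] F, ∀ (g : G) (x : E), U (π g x) = ρ g (U x)

/-- `ρ ≺ π`: `‖ρ(x)‖ ≤ ‖π(x)‖` for all `x` in `ℂ[G]`; since `ℂ[G]` is dense in the
maximal C*-algebra `C*(G)`, this is the same as the inequality for all `x` in `C*(G)`. -/
def WeaklyContained (ρ : UnitaryRep G F) (π : UnitaryRep G E) : Prop :=
  ∀ x : MonoidAlgebra ℂ G, ‖groupAlgebraHom ρ x‖ ≤ ‖groupAlgebraHom π x‖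

/-- Weak equivalence `ρ ∼ π`. -/
def WeaklyEquivalent (ρ : UnitaryRep G F) (π : UnitaryRep G E) : Prop :=
  WeaklyContained ρ π ∧ WeaklyContained π ρ

/-- The trivial representation `1_G` on `ℂ`. -/
def trivial (G : Type u) [Group G] : UnitaryRep G ℂ := 1

/-- `C*_π(G)` contains all compact operators. -/
def ContainsCompacts (π : UnitaryRep G E) : Prop :=
  ∀ T : E →L[ℂ] E, IsCompactOperator T → T ∈ cstar π

/-- `π` is factorial: the centre of the von Neumann algebra `W*_π(G)` consists of the scalar
operators (and the space is non-zero). -/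
def IsFactorial (π : UnitaryRep G E) : Prop :=
  Nontrivial E ∧ ∀ T ∈ vonNeumann π, (∀ S ∈ vonNeumann π, T * S = S * T) →
    ∃ c : ℂ, T = c • (1 : E →L[ℂ] E)

end General

section Trace

variable {E : Type v} [NormedAddCommGroup E] [InnerProductSpace ℂ E] [CompleteSpace E]

/-- `τ` restricts to a faithful normal (not necessarily finite) trace on the positive cone of the
von Neumann algebra `W ⊆ B(E)`; the values of `τ` elsewhere are irrelevant. -/
structure IsFaithfulNormalTrace (W : Set (E →L[ℂ] E)) (τ : (E →L[ℂ] E) → ℝ≥0∞) : Prop where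
  map_add : ∀ x ∈ W, ∀ y ∈ W, 0 ≤ x → 0 ≤ y → τ (x + y) = τ x + τ y
  map_smul : ∀ x ∈ W, 0 ≤ x → ∀ c : NNReal, τ (((c : ℝ) : ℂ) • x) = (c : ℝ≥0∞) * τ x
  tracial : ∀ x ∈ W, τ (star x * x) = τ (x * star x)
  faithful : ∀ x ∈ W, 0 ≤ x → τ x = 0 → x = 0
  normal : ∀ D ⊆ W, D.Nonempty → (∀ d ∈ D, 0 ≤ d) → DirectedOn (· ≤ ·) D →
    ∀ x ∈ W, IsLUB D x → τ x = ⨆ d ∈ D, τ d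

/-- A factorial representation `π` is traceable (or normal) if there are a faithful normal trace
`τ` on `W*_π(G)` and a positive `x ∈ C*_π(G)` with `0 < τ(x) < ∞`. -/
def IsTraceable {G : Type u} [Group G] (π : UnitaryRep G E) : Prop :=
  IsFactorial π ∧ ∃ τ : (E →L[ℂ] E) → ℝ≥0∞, IsFaithfulNormalTrace (vonNeumann π) τ ∧
    ∃ x ∈ cstar π, 0 ≤ x ∧ 0 < τ x ∧ τ x < ∞

end Trace

section Permutation

variable (G : Type u) [Group G] (X : Type v) [MulAction G X]

theorem memℓp_translate (g : G) {f : X → ℂ} (hf : Memℓp f 2) :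
    Memℓp (fun x => f (g⁻¹ • x)) 2 := by
  rw [memℓp_gen_iff (by norm_num)] at hf ⊢
  exact hf.comp_injective (MulAction.injective g⁻¹)

/-- Translation by `g` on `ℓ²(X)`, as a linear map. -/
def translate (g : G) : lp (fun _ : X => ℂ) 2 →ₗ[ℂ] lp (fun _ : X => ℂ) 2 where
  toFun f := ⟨fun x => f (g⁻¹ • x), memℓp_translate G X g (lp.memℓp f)⟩
  map_add' _ _ := rfl
  map_smul' _ _ := rfl

@[simp]
theorem translate_apply (g : G) (f : lp (fun _ : X => ℂ) 2) (x : X) :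
    translate G X g f x = f (g⁻¹ • x) := rfl

theorem norm_translate (g : G) (f : lp (fun _ : X => ℂ) 2) : ‖translate G X g f‖ = ‖f‖ := by
  have h : (0 : ℝ) < (2 : ℝ≥0∞).toReal := by norm_num
  rw [lp.norm_eq_tsum_rpow h, lp.norm_eq_tsum_rpow h]
  congr 1
  exact (MulAction.toPerm g⁻¹).tsum_eq (fun x => ‖f x‖ ^ (2 : ℝ≥0∞).toReal)

/-- The natural representation `π_X` of `G` on `ℓ²(X)`: `(π_X(g) f)(x) = f(g⁻¹ x)`. -/
def permutation : UnitaryRep G (lp (fun _ : X => ℂ) 2) where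
  toFun g :=
    { toLinearEquiv := LinearEquiv.ofLinearMap (translate G X g) (translate G X g⁻¹)
        (by ext f x; simp) (by ext f x; simp)
      norm_map' := norm_translate G X g }
  map_one' := by
    ext f x
    change f ((1 : G)⁻¹ • x) = f x
    simp
  map_mul' a b := by
    ext f x
    change f ((a * b)⁻¹ • x) = f (b⁻¹ • a⁻¹ • x)
    rw [mul_inv_rev, mul_smul]

@[simp]
theorem permutation_apply (g : G) (f : lp (fun _ : X => ℂ) 2) (x : X) :
    permutation G X g f x = f (g⁻¹ • x) := rfl

/-- The action of `G` on `X` has a spectral gap: `π_X` does not weakly contain `1_G`. -/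
def HasSpectralGap : Prop := ¬ WeaklyContained (trivial G) (permutation G X)

end Permutation

section Subgroups

variable {G : Type u} [Group G]

/-- `G/H ∖ {H}` with the natural action of `H`. -/
def cosetsAwayFromBase (H : Subgroup G) : SubMulAction H (G ⧸ H) where
  carrier := {q | q ≠ ((1 : G) : G ⧸ H)}
  smul_mem' h q hq := by
    intro hh
    apply hq
    have : q = h⁻¹ • ((1 : G) : G ⧸ H) := by rw [← hh, inv_smul_smul]
    rw [this]
    change (((h⁻¹ : H) : G) * 1 : G) = ((1 : G) : G ⧸ H)
    rw [QuotientGroup.eq]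
    simp

/-- `H` has the spectral gap property: the action of `H` on `G/H ∖ {H}` has a spectral gap. -/
def HasSpectralGapProperty (H : Subgroup G) : Prop :=
  HasSpectralGap H (cosetsAwayFromBase H)

/-- `H` is self-commensurating: `Comm_G(H) = H`. -/
def IsSelfCommensurating (H : Subgroup G) : Prop :=
  Subgroup.Commensurable.commensurator H = H

/-- The conjugate `g⁻¹ L g = {x | g x g⁻¹ ∈ L}`. -/
def conjSubgroup (L : Subgroup G) (g : G) : Subgroup G :=
  L.comap (MulAut.conj g).toMonoidHom

/-- The representation `σ^g` of `g⁻¹ L g`: `σ^g(x) = σ(g x g⁻¹)`. -/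
def conjRep {E : Type v} [NormedAddCommGroup E] [InnerProductSpace ℂ E]
    {L : Subgroup G} (σ : UnitaryRep L E) (g : G) : UnitaryRep (conjSubgroup L g) E :=
  σ.comp ((MulAut.conj g).toMonoidHom.subgroupComap L)

end Subgroups

section Induced

variable {G : Type u} [Group G] {H : Subgroup G}
variable {K : Type v} [NormedAddCommGroup K] [InnerProductSpace ℂ K]

/-- The maps `f : G → K` with `f(xh) = σ(h⁻¹) f(x)` for `x ∈ G`, `h ∈ H`, and
`∑_{x ∈ G/H} ‖f(x)‖² < ∞` (the norm of `f(x)` depends only on the coset `xH`). -/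
def inducedSubmodule (σ : UnitaryRep H K) : Submodule ℂ (G → K) where
  carrier := {f | (∀ (x : G) (h : H), f (x * h) = σ h⁻¹ (f x)) ∧
    Summable fun q : G ⧸ H => ‖f q.out‖ ^ 2}
  zero_mem' := by
    refine ⟨fun x h => by simp, ?_⟩
    simp
  add_mem' := by
    rintro a b ⟨ha, ha'⟩ ⟨hb, hb'⟩
    refine ⟨fun x h => by simp [ha, hb], ?_⟩
    refine Summable.of_nonneg_of_le (fun _ => by positivity) (fun q => ?_)
      ((ha'.add hb').mul_left 2)
    have h1 := norm_add_le (a q.out) (b q.out)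
    have h2 := norm_nonneg (a q.out + b q.out)
    simp only [Pi.add_apply]
    nlinarith [sq_nonneg (‖a q.out‖ - ‖b q.out‖)]
  smul_mem' := by
    rintro c a ⟨ha, ha'⟩
    refine ⟨fun x h => by simp [ha], ?_⟩
    simpa [norm_smul, mul_pow] using ha'.mul_left (‖c‖ ^ 2)

/-- The space of the induced representation (a type of its own, so that it carries the `ℓ²`
topology and not that of pointwise convergence). -/
def InducedSpace (σ : UnitaryRep H K) : Type (max u v) := inducedSubmodule σ

namespace InducedSpace

variable {σ : UnitaryRep H K}

instance : AddCommGroup (InducedSpace σ) := inferInstanceAs (AddCommGroup (inducedSubmodule σ))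

instance : Module ℂ (InducedSpace σ) := inferInstanceAs (Module ℂ (inducedSubmodule σ))

/-- The underlying map `G → K`. -/
def toFun (f : InducedSpace σ) : G → K := Subtype.val (p := (· ∈ inducedSubmodule σ)) f

instance : CoeFun (InducedSpace σ) (fun _ => G → K) := ⟨toFun⟩

/-- An element of the space of the induced representation from its defining properties. -/
def mk (f : G → K) (h₁ : ∀ (x : G) (h : H), f (x * h) = σ h⁻¹ (f x))
    (h₂ : Summable fun q : G ⧸ H => ‖f q.out‖ ^ 2) : InducedSpace σ :=
  (⟨f, h₁, h₂⟩ : inducedSubmodule σ)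

@[simp]
theorem mk_apply (f : G → K) (h₁ : ∀ (x : G) (h : H), f (x * h) = σ h⁻¹ (f x))
    (h₂ : Summable fun q : G ⧸ H => ‖f q.out‖ ^ 2) (x : G) : mk f h₁ h₂ x = f x := rfl

@[ext]
theorem ext {f f' : InducedSpace σ} (h : ∀ x, f x = f' x) : f = f' := Subtype.ext (funext h)

@[simp]
theorem add_apply (f f' : InducedSpace σ) (x : G) : (f + f') x = f x + f' x := rfl

@[simp]
theorem smul_apply (c : ℂ) (f : InducedSpace σ) (x : G) : (c • f) x = c • f x := rfl

@[simp]
theorem zero_apply (x : G) : (0 : InducedSpace σ) x = 0 := rfl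

theorem apply_mul (f : InducedSpace σ) (x : G) (h : H) : f (x * h) = σ h⁻¹ (f x) :=
  (Subtype.property (p := (· ∈ inducedSubmodule σ)) f).1 x h

theorem summable_norm_sq (f : InducedSpace σ) : Summable fun q : G ⧸ H => ‖f q.out‖ ^ 2 :=
  (Subtype.property (p := (· ∈ inducedSubmodule σ)) f).2

theorem norm_apply_eq (f : InducedSpace σ) {x y : G} (hxy : (x : G ⧸ H) = y) : ‖f x‖ = ‖f y‖ := by
  rw [QuotientGroup.eq] at hxy
  have h := f.apply_mul x ⟨_, hxy⟩
  simp only [mul_inv_cancel_left] at h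
  rw [h, LinearIsometryEquiv.norm_map]

/-- Restriction to a system of representatives of `G/H`. -/
def toLp (f : InducedSpace σ) : lp (fun _ : G ⧸ H => K) 2 :=
  ⟨fun q => f q.out, (memℓp_gen_iff (by norm_num)).mpr (by simpa using f.summable_norm_sq)⟩

@[simp]
theorem toLp_apply (f : InducedSpace σ) (q : G ⧸ H) : toLp f q = f q.out := rfl

theorem toLp_add (f f' : InducedSpace σ) : toLp (f + f') = toLp f + toLp f' := rfl

theorem toLp_smul (c : ℂ) (f : InducedSpace σ) : toLp (c • f) = c • toLp f := rfl

theorem eq_of_out (f : InducedSpace σ) (x : G) :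
    f x = σ ⟨x⁻¹ * (x : G ⧸ H).out, QuotientGroup.eq.mp (by simp)⟩ (f (x : G ⧸ H).out) := by
  have h := f.apply_mul x ⟨x⁻¹ * (x : G ⧸ H).out, QuotientGroup.eq.mp (by simp)⟩
  simp only [mul_inv_cancel_left] at h
  rw [h, map_inv]
  exact ((σ _).apply_symm_apply _).symm

theorem toLp_injective : Function.Injective (toLp : InducedSpace σ → _) := by
  intro f f' h
  ext x
  have h' : f (x : G ⧸ H).out = f' (x : G ⧸ H).out :=
    congrArg (fun k : lp (fun _ : G ⧸ H => K) 2 => k (x : G ⧸ H)) h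
  rw [f.eq_of_out, f'.eq_of_out, h']

/-- The inner product `⟪f, f'⟫ = ∑_{x ∈ G/H} ⟪f(x), f'(x)⟫`. -/
@[reducible]
def core : InnerProductSpace.Core ℂ (InducedSpace σ) where
  inner f f' := ∑' q : G ⧸ H, ⟪f q.out, f' q.out⟫_ℂ
  conj_inner_symm f f' := by
    have h := inner_conj_symm (𝕜 := ℂ) (toLp f) (toLp f')
    rwa [lp.inner_eq_tsum, lp.inner_eq_tsum] at h
  re_inner_nonneg f := by
    have h := inner_self_nonneg (𝕜 := ℂ) (x := toLp f)
    rwa [lp.inner_eq_tsum] at h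
  add_left f f' f'' := by
    have h := inner_add_left (𝕜 := ℂ) (toLp f) (toLp f') (toLp f'')
    rwa [lp.inner_eq_tsum, lp.inner_eq_tsum, lp.inner_eq_tsum] at h
  smul_left f f' c := by
    have h := inner_smul_left (𝕜 := ℂ) (toLp f) (toLp f') c
    rwa [lp.inner_eq_tsum, lp.inner_eq_tsum] at h
  definite f hf := by
    have h : ⟪toLp f, toLp f⟫_ℂ = 0 := by rwa [lp.inner_eq_tsum]
    exact toLp_injective (inner_self_eq_zero.mp h)

instance : NormedAddCommGroup (InducedSpace σ) := core.toNormedAddCommGroup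

instance : InnerProductSpace ℂ (InducedSpace σ) := InnerProductSpace.ofCore core.toCore

theorem inner_def (f f' : InducedSpace σ) :
    ⟪f, f'⟫_ℂ = ∑' q : G ⧸ H, ⟪f q.out, f' q.out⟫_ℂ := rfl

theorem inner_toLp (f f' : InducedSpace σ) : ⟪toLp f, toLp f'⟫_ℂ = ⟪f, f'⟫_ℂ := by
  rw [lp.inner_eq_tsum, inner_def]
  rfl

theorem norm_toLp (f : InducedSpace σ) : ‖toLp f‖ = ‖f‖ := by
  rw [@norm_eq_sqrt_re_inner ℂ, @norm_eq_sqrt_re_inner ℂ, inner_toLp]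

theorem norm_sq_eq (f : InducedSpace σ) : ‖f‖ ^ 2 = ∑' q : G ⧸ H, ‖f q.out‖ ^ 2 := by
  have h := lp.norm_rpow_eq_tsum (p := 2) (by norm_num) (toLp f)
  rw [norm_toLp] at h
  simpa using h

/-- The extension of an `ℓ²` map on representatives to an equivariant map on `G`. -/
def ofLp (σ : UnitaryRep H K) (f : lp (fun _ : G ⧸ H => K) 2) : InducedSpace σ :=
  mk (fun x => σ ⟨x⁻¹ * (x : G ⧸ H).out, QuotientGroup.eq.mp (by simp)⟩ (f (x : G ⧸ H)))
    (by
      intro x h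
      have hq : ((x * h : G) : G ⧸ H) = x := by simp
      have : ∀ (q : G ⧸ H) (hq : q = (x : G ⧸ H)) (hm : (x * (h : G))⁻¹ * q.out ∈ H),
          σ ⟨(x * (h : G))⁻¹ * q.out, hm⟩ (f q) =
            σ h⁻¹ (σ ⟨x⁻¹ * (x : G ⧸ H).out, QuotientGroup.eq.mp (by simp)⟩ (f (x : G ⧸ H))) := by
        rintro q rfl hm
        rw [← Function.comp_apply (f := σ h⁻¹), ← LinearIsometryEquiv.coe_mul, ← map_mul]
        congr 2
        ext
        simp [mul_assoc]
      exact this _ hq _)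
    (by
      have h := lp.memℓp f
      rw [memℓp_gen_iff (by norm_num)] at h
      simpa using h)

theorem toLp_ofLp (f : lp (fun _ : G ⧸ H => K) 2) : toLp (ofLp σ f) = f := by
  ext q
  change σ ⟨q.out⁻¹ * ((q.out : G) : G ⧸ H).out, _⟩ (f ((q.out : G) : G ⧸ H)) = f q
  have : ∀ (r : G ⧸ H) (hr : r = q) (hm : q.out⁻¹ * r.out ∈ H),
      σ ⟨q.out⁻¹ * r.out, hm⟩ (f r) = f q := by
    rintro r rfl hm
    have : (⟨r.out⁻¹ * r.out, hm⟩ : H) = 1 := by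
      ext
      simp
    rw [this, map_one]
    rfl
  exact this _ (by simp) _

/-- Restriction to representatives is an isometry onto `ℓ²(G/H, K)`. -/
def toLpEquiv (σ : UnitaryRep H K) : InducedSpace σ ≃ₗᵢ[ℂ] lp (fun _ : G ⧸ H => K) 2 where
  toFun := toLp
  invFun := ofLp σ
  map_add' := toLp_add
  map_smul' := toLp_smul
  left_inv _ := toLp_injective (toLp_ofLp _)
  right_inv := toLp_ofLp
  norm_map' := norm_toLp

instance [CompleteSpace K] : CompleteSpace (InducedSpace σ) :=
  (toLpEquiv σ).toIsometryEquiv.completeSpace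

theorem norm_out_smul (f : InducedSpace σ) (g : G) (q : G ⧸ H) :
    ‖f (g * q.out)‖ = ‖f (g • q).out‖ := by
  apply norm_apply_eq
  rw [QuotientGroup.out_eq', ← smul_eq_mul, MulAction.Quotient.coe_smul_out]

/-- Left translation `(π(g) f)(x) = f(g⁻¹ x)`, as a linear map. -/
def leftTranslate (σ : UnitaryRep H K) (g : G) : InducedSpace σ →ₗ[ℂ] InducedSpace σ where
  toFun f := mk (fun x => f (g⁻¹ * x))
    (fun x h => by simp only [← mul_assoc, f.apply_mul])
    (by
      simp only [norm_out_smul]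
      exact f.summable_norm_sq.comp_injective (MulAction.injective g⁻¹))
  map_add' _ _ := rfl
  map_smul' _ _ := rfl

@[simp]
theorem leftTranslate_apply (g : G) (f : InducedSpace σ) (x : G) :
    leftTranslate σ g f x = f (g⁻¹ * x) := rfl

theorem norm_leftTranslate (g : G) (f : InducedSpace σ) : ‖leftTranslate σ g f‖ = ‖f‖ := by
  rw [← sq_eq_sq₀ (norm_nonneg _) (norm_nonneg _), norm_sq_eq, norm_sq_eq]
  simp only [leftTranslate_apply, norm_out_smul]
  exact (MulAction.toPerm (g⁻¹ : G)).tsum_eq (fun q : G ⧸ H => ‖f q.out‖ ^ 2)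

end InducedSpace

/-- The induced representation `Ind_H^G σ`: `(π(g) f)(x) = f(g⁻¹ x)`. -/
def induced (σ : UnitaryRep H K) : UnitaryRep G (InducedSpace σ) where
  toFun g :=
    { toLinearEquiv := LinearEquiv.ofLinearMap (InducedSpace.leftTranslate σ g) (InducedSpace.leftTranslate σ g⁻¹)
        (by ext f x; simp) (by ext f x; simp)
      norm_map' := InducedSpace.norm_leftTranslate g }
  map_one' := by
    ext f x
    change f ((1 : G)⁻¹ * x) = f x
    simp
  map_mul' a b := by
    ext f x
    change f ((a * b)⁻¹ * x) = f (b⁻¹ * (a⁻¹ * x))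
    rw [mul_inv_rev, mul_assoc]

@[simp]
theorem induced_apply (σ : UnitaryRep H K) (g : G) (f : InducedSpace σ) (x : G) :
    induced σ g f x = f (g⁻¹ * x) := rfl

end Induced

end UnitaryRep

end

noncomputable section

namespace UnitaryRep

open Filter Topology

/-! ### Group algebra operators, Schur's lemma and Burnside's theorem -/

section GroupAlgebra

variable {G : Type u} [Group G]
variable {E : Type v} [NormedAddCommGroup E] [InnerProductSpace ℂ E]
variable {F : Type w} [NormedAddCommGroup F] [InnerProductSpace ℂ F]

/-! Write `ρ` for `Ind σ`. Restricted to `H`, it splits as the copy of `K` formed by the functions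
supported on `H`, where `H` acts by `σ`, plus the functions supported off `H`, which are those
vanishing at `1`. Everything rests on one fact: `C*_ρ(G)` contains the rank-one operators of `K`
extended by zero (`corner_mem_cstar`).

The spectral gap produces them by keeping `σ` away from the functions off `H`. Let `T` be a linear
map from `K` to these functions that almost intertwines `σ` with `ρ`. The norm of `T` followed by
evaluation at `x` depends only on the coset of `x`. It is an almost invariant scalar function in
`ℓ²(G/H ∖ {H})`, because precomposition with the unitaries `σ(s)` leaves norms unchanged; so it is
small (`norm_sq_le_of_gap`). Hence some `a` in `ℂ[H]` fixes a unit vector of `K`, acts as a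
contraction, and is a strict contraction off `H`. Its powers tend to `0` in norm off `H`, and
subconverge on the finite-dimensional space `K`. The limit is a non-zero operator on `K` extended by
zero, and Burnside's theorem turns it into any rank-one operator of `K`.

Irreducibility follows, because a closed invariant subspace is stable under these corners and the
translates of `K` are total. Translating the corners also gives all rank-one operators
(`rankOne_mem_cstar`), hence all compact operators, and traceability with the usual operator trace.

If `π ∼ ρ`, then `C*_ρ(G) ≅ C*_π(G)`, and the images of the rank-one operators yield an isometric
intertwiner from `ρ` to `π` (`WeaklyEquivalent.exists_isometric_intertwiner`). For irreducible `π`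
it is onto. If instead `π` is induced from a finite-dimensional representation of `L`, square
summability forces finite orbits of `H` on `G/L`, and the adjoint gives finite orbits of a conjugate
of `L` on `G/H`. So `H` is commensurable with a conjugate of `L`. Both are self-commensurating, `H`
because a gap excludes finite orbits, so they coincide. Evaluation at a point then intertwines the
inducing representations. -/

@[simp]
theorem groupAlgebraHom_single (π : UnitaryRep G E) (g : G) (c : ℂ) :
    groupAlgebraHom π (MonoidAlgebra.single g c) = c • toOperators π g :=
  MonoidAlgebra.lift_single _ _ _

theorem inner_rep_left (π : UnitaryRep G E) (g : G) (x y : E) :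
    ⟪π g x, y⟫_ℂ = ⟪x, π g⁻¹ y⟫_ℂ := by
  rw [map_inv]
  exact LinearIsometryEquiv.inner_map_eq_flip _ _ _

theorem star_toOperators [CompleteSpace E] (π : UnitaryRep G E) (g : G) :
    star (toOperators π g) = toOperators π g⁻¹ := by
  rw [ContinuousLinearMap.star_eq_adjoint, eq_comm, ContinuousLinearMap.eq_adjoint_iff]
  intro x y
  rw [toOperators_apply, toOperators_apply, inner_rep_left, inv_inv]

/-- The group algebra has an involution which every pair of unitary representations respects. -/
theorem exists_groupAlgebraHom_eq_star [CompleteSpace E] [CompleteSpace F]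
    (π : UnitaryRep G E) (ρ : UnitaryRep G F) (x : MonoidAlgebra ℂ G) :
    ∃ y, groupAlgebraHom π y = star (groupAlgebraHom π x) ∧
      groupAlgebraHom ρ y = star (groupAlgebraHom ρ x) := by
  induction x using MonoidAlgebra.induction_linear with
  | zero => exact ⟨0, by simp, by simp⟩
  | add a b ha hb =>
    obtain ⟨a', h₁, h₂⟩ := ha
    obtain ⟨b', h₃, h₄⟩ := hb
    exact ⟨a' + b', by simp [h₁, h₃], by simp [h₂, h₄]⟩
  | single g c =>
    exact ⟨MonoidAlgebra.single g⁻¹ (star c), by simp [star_toOperators],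
      by simp [star_toOperators]⟩

theorem exists_groupAlgebraHom_eq_adjoint [CompleteSpace E]
    (π : UnitaryRep G E) (x : MonoidAlgebra ℂ G) :
    ∃ y, groupAlgebraHom π y = star (groupAlgebraHom π x) :=
  (exists_groupAlgebraHom_eq_star π π x).imp fun _ h => h.1

/-- An intertwiner for the group action is an intertwiner for the group algebra. -/
theorem map_groupAlgebraHom {π : UnitaryRep G E} {ρ : UnitaryRep G F} (T : E →L[ℂ] F)
    (hT : ∀ g x, T (π g x) = ρ g (T x)) (a : MonoidAlgebra ℂ G) (x : E) :
    T (groupAlgebraHom π a x) = groupAlgebraHom ρ a (T x) := by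
  induction a using MonoidAlgebra.induction_linear generalizing x with
  | zero => simp
  | add a b ha hb => simp [ha, hb]
  | single g c => simp [hT]

theorem groupAlgebraHom_mem {π : UnitaryRep G E} (S : Submodule ℂ E)
    (hS : ∀ g, ∀ x ∈ S, π g x ∈ S) (a : MonoidAlgebra ℂ G) {x : E} (hx : x ∈ S) :
    groupAlgebraHom π a x ∈ S := by
  induction a using MonoidAlgebra.induction_linear with
  | zero => simp
  | add a b ha hb => simpa using S.add_mem ha hb
  | single g c => simpa using S.smul_mem _ (hS g x hx)

theorem groupAlgebraHom_comp_mem_range {G' : Type w} [Group G'] (π : UnitaryRep G E)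
    (j : G' →* G) (a : MonoidAlgebra ℂ G') :
    groupAlgebraHom (π.comp j : UnitaryRep G' E) a ∈ Set.range (groupAlgebraHom π) := by
  induction a using MonoidAlgebra.induction_linear with
  | zero => exact ⟨0, by simp⟩
  | add a b ha hb =>
    obtain ⟨a', ha⟩ := ha
    obtain ⟨b', hb⟩ := hb
    exact ⟨a' + b', by simp [ha, hb]⟩
  | single g c => exact ⟨MonoidAlgebra.single (j g) c, by simp; rfl⟩

/-- `C*_π(G)` as a subalgebra of `B(E)`. -/
def cstarSubalgebra (π : UnitaryRep G E) : Subalgebra ℂ (E →L[ℂ] E) :=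
  (groupAlgebraHom π).range.topologicalClosure

theorem mem_cstarSubalgebra {π : UnitaryRep G E} {T : E →L[ℂ] E} :
    T ∈ cstarSubalgebra π ↔ T ∈ cstar π := by
  rw [cstarSubalgebra, cstar, ← SetLike.mem_coe, Subalgebra.topologicalClosure_coe,
    AlgHom.coe_range]

theorem groupAlgebraHom_mem_cstar (π : UnitaryRep G E) (a : MonoidAlgebra ℂ G) :
    groupAlgebraHom π a ∈ cstarSubalgebra π :=
  mem_cstarSubalgebra.mpr (subset_closure ⟨a, rfl⟩)

theorem isClosed_cstarSubalgebra (π : UnitaryRep G E) :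
    IsClosed (cstarSubalgebra π : Set (E →L[ℂ] E)) :=
  Subalgebra.isClosed_topologicalClosure _

theorem cstar_apply_mem {π : UnitaryRep G E} {S : Submodule ℂ E} (hc : IsClosed (S : Set E))
    (hS : ∀ g, ∀ x ∈ S, π g x ∈ S) {T : E →L[ℂ] E} (hT : T ∈ cstarSubalgebra π)
    {x : E} (hx : x ∈ S) : T x ∈ S := by
  rw [mem_cstarSubalgebra] at hT
  have : cstar π ⊆ {T : E →L[ℂ] E | T x ∈ S} := by
    apply closure_minimal
    · rintro _ ⟨a, rfl⟩
      exact groupAlgebraHom_mem S hS a hx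
    · exact hc.preimage (ContinuousLinearMap.apply ℂ E x).continuous
  exact this hT

theorem IsIrreducible.exists_groupAlgebraHom_apply_eq [FiniteDimensional ℂ E]
    {π : UnitaryRep G E} (hπ : π.IsIrreducible) {v : E} (hv : v ≠ 0) (u : E) :
    ∃ a, groupAlgebraHom π a v = u := by
  let S : Submodule ℂ E := LinearMap.range
    ((ContinuousLinearMap.apply ℂ E v : (E →L[ℂ] E) →ₗ[ℂ] E) ∘ₗ (groupAlgebraHom π).toLinearMap)
  have hS : S = ⊥ ∨ S = ⊤ := by
    refine hπ.2 S S.closed_of_finiteDimensional ?_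
    rintro g _ ⟨a, rfl⟩
    exact ⟨MonoidAlgebra.single g 1 * a, by simp⟩
  have hvS : v ∈ S := ⟨1, by simp⟩
  rcases hS with hS | hS
  · rw [hS] at hvS
    exact absurd (by simpa using hvS) hv
  · have : u ∈ S := hS ▸ Submodule.mem_top
    obtain ⟨a, ha⟩ := this
    exact ⟨a, ha⟩

/-- Schur's lemma for finite-dimensional unitary representations. -/
theorem IsIrreducible.exists_eq_smul_of_commute [FiniteDimensional ℂ E]
    {π : UnitaryRep G E} (hπ : π.IsIrreducible) (T : E →ₗ[ℂ] E)
    (hT : ∀ g x, T (π g x) = π g (T x)) : ∃ c : ℂ, ∀ x, T x = c • x := by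
  have := hπ.1
  obtain ⟨c, hc⟩ := Module.End.exists_eigenvalue T
  refine ⟨c, fun x => ?_⟩
  let S := Module.End.eigenspace T c
  have hS : S = ⊥ ∨ S = ⊤ := by
    refine hπ.2 S S.closed_of_finiteDimensional ?_
    intro g x hx
    rw [Module.End.mem_eigenspace_iff] at hx ⊢
    rw [hT, hx, map_smul]
  rcases hS with hS | hS
  · exact absurd hS hc
  · exact Module.End.mem_eigenspace_iff.mp (hS ▸ Submodule.mem_top : x ∈ S)

/-- Burnside's theorem: the operators of a finite-dimensional irreducible representation span. -/
theorem IsIrreducible.groupAlgebraHom_surjective [FiniteDimensional ℂ E]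
    {π : UnitaryRep G E} (hπ : π.IsIrreducible) :
    Function.Surjective (groupAlgebraHom π) := by
  intro B
  let : Module (MonoidAlgebra ℂ G) E :=
    Module.compHom E (groupAlgebraHom π : MonoidAlgebra ℂ G →+* (E →L[ℂ] E))
  have hsmul (a : MonoidAlgebra ℂ G) (x : E) : a • x = groupAlgebraHom π a x := rfl
  have := hπ.1
  have : IsSimpleModule (MonoidAlgebra ℂ G) E := by
    rw [isSimpleModule_iff_toSpanSingleton_surjective]
    refine ⟨hπ.1, fun v hv u => ?_⟩
    obtain ⟨a, ha⟩ := hπ.exists_groupAlgebraHom_apply_eq hv u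
    exact ⟨a, ha⟩
  have hcomm (T : Module.End (MonoidAlgebra ℂ G) E) : ∃ c : ℂ, ∀ x, T x = c • x := by
    have hs (c : ℂ) (x : E) : c • x = (MonoidAlgebra.single 1 c : MonoidAlgebra ℂ G) • x := by
      simp [hsmul]
    refine hπ.exists_eq_smul_of_commute
      { toFun := T, map_add' := map_add T, map_smul' := fun c x => ?_ } fun g x => ?_
    · rw [hs, map_smul, RingHom.id_apply, hs]
    · have := T.map_smul (MonoidAlgebra.single g 1) x
      simpa [hsmul] using this
  -- Schur's lemma makes the commutant scalar, so every linear `B` lies in the double commutant, and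
  -- the density theorem on a basis realises it exactly.
  let f : Module.End (Module.End (MonoidAlgebra ℂ G) E) E :=
    { toFun := B
      map_add' := map_add B
      map_smul' := fun T x => by
        obtain ⟨c, hc⟩ := hcomm T
        change B (T x) = T (B x)
        rw [hc, hc, map_smul] }
  let b := Module.finBasis ℂ E
  classical
  obtain ⟨a, ha⟩ := jacobson_density f (Finset.univ.image b)
  refine ⟨a, ?_⟩
  apply ContinuousLinearMap.coe_injective
  refine b.ext fun i => ?_
  exact (ha (b i) (by simp)).symm

end GroupAlgebra

/-! ### Evaluation, and the functions supported on `H` -/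

namespace InducedSpace

variable {G : Type u} [Group G] {H : Subgroup G}
variable {K : Type v} [NormedAddCommGroup K] [InnerProductSpace ℂ K] {σ : UnitaryRep H K}

@[simp]
theorem sub_apply (f f' : InducedSpace σ) (x : G) : (f - f') x = f x - f' x := rfl

theorem norm_apply_le (f : InducedSpace σ) (x : G) : ‖f x‖ ≤ ‖f‖ := by
  have h : ‖f x‖ ^ 2 ≤ ‖f‖ ^ 2 := by
    rw [norm_sq_eq, norm_apply_eq f (y := (x : G ⧸ H).out) (by simp)]
    exact f.summable_norm_sq.le_tsum (x : G ⧸ H) fun _ _ => by positivity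
  exact le_of_sq_le_sq h (norm_nonneg _)

/-- Evaluation at `x`, as a bounded operator. -/
def evalCLM (σ : UnitaryRep H K) (x : G) : InducedSpace σ →L[ℂ] K :=
  LinearMap.mkContinuous
    { toFun := fun f => f x, map_add' := fun _ _ => rfl, map_smul' := fun _ _ => rfl } 1
    fun f => by rw [one_mul]; exact norm_apply_le f x

@[simp]
theorem evalCLM_apply (x : G) (f : InducedSpace σ) : evalCLM σ x f = f x := rfl

theorem out_mem_iff (q : G ⧸ H) : q.out ∈ H ↔ q = ((1 : G) : G ⧸ H) := by
  rw [← QuotientGroup.out_eq' q, eq_comm, QuotientGroup.eq, QuotientGroup.out_eq']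
  simp

open Classical in
/-- The function supported on `H` with value `k` at `1`. -/
def bump (σ : UnitaryRep H K) (k : K) : InducedSpace σ :=
  mk (fun x => if hx : x ∈ H then σ ⟨x, hx⟩⁻¹ k else 0)
    (fun x h => by
      by_cases hx : x ∈ H
      · have hxh : x * h ∈ H := H.mul_mem hx h.2
        have : (⟨x * h, hxh⟩ : H)⁻¹ = h⁻¹ * ⟨x, hx⟩⁻¹ := by
          rw [← mul_inv_rev]
          rfl
        rw [dif_pos hx, dif_pos hxh, this, map_mul]
        rfl
      · have hxh : x * h ∉ H := fun hh => hx ((H.mul_mem_cancel_right h.2).mp hh)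
        simp [hx, hxh])
    (summable_of_hasFiniteSupport ((Set.finite_singleton ((1 : G) : G ⧸ H)).subset fun q hq => by
      by_contra hne
      have : q.out ∉ H := fun h => hne ((out_mem_iff q).mp h)
      simp [this] at hq))

theorem bump_apply_of_mem (k : K) {x : G} (hx : x ∈ H) : bump σ k x = σ ⟨x, hx⟩⁻¹ k := by
  simp only [bump, mk_apply, dif_pos hx]

theorem bump_apply_of_notMem (k : K) {x : G} (hx : x ∉ H) : bump σ k x = 0 := by
  simp only [bump, mk_apply, dif_neg hx]

@[simp]
theorem bump_apply_one (k : K) : bump σ k 1 = k := by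
  rw [bump_apply_of_mem k H.one_mem]
  have : (⟨1, H.one_mem⟩ : H)⁻¹ = 1 := inv_one
  rw [this, map_one]
  rfl

theorem inner_bump_left (k : K) (f : InducedSpace σ) : ⟪bump σ k, f⟫_ℂ = ⟪k, f 1⟫_ℂ := by
  rw [inner_def, tsum_eq_single ((1 : G) : G ⧸ H)]
  · have ho := (out_mem_iff ((1 : G) : G ⧸ H)).mpr rfl
    have h := f.apply_mul 1 ⟨_, ho⟩
    rw [one_mul] at h
    rw [h, bump_apply_of_mem k ho, LinearIsometryEquiv.inner_map_map]
  · intro q hq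
    rw [bump_apply_of_notMem k (fun h => hq ((out_mem_iff q).mp h)), inner_zero_left]

/-- The embedding of the space of `σ` as the functions supported on `H`. -/
def inclCLM (σ : UnitaryRep H K) : K →L[ℂ] InducedSpace σ :=
  LinearMap.mkContinuous
    { toFun := bump σ
      map_add' := fun a b => by
        ext x
        by_cases hx : x ∈ H
        · simp [bump_apply_of_mem, hx]
        · simp [bump_apply_of_notMem, hx]
      map_smul' := fun c a => by
        ext x
        by_cases hx : x ∈ H
        · simp [bump_apply_of_mem, hx]
        · simp [bump_apply_of_notMem, hx] } 1
    fun k => by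
      rw [one_mul]
      change ‖bump σ k‖ ≤ ‖k‖
      rw [@norm_eq_sqrt_re_inner ℂ, @norm_eq_sqrt_re_inner ℂ, inner_bump_left, bump_apply_one]

@[simp]
theorem inclCLM_apply_one (k : K) : inclCLM σ k 1 = k := bump_apply_one k

theorem inner_inclCLM_left (k : K) (f : InducedSpace σ) : ⟪inclCLM σ k, f⟫_ℂ = ⟪k, f 1⟫_ℂ :=
  inner_bump_left k f

@[simp]
theorem norm_inclCLM (k : K) : ‖inclCLM σ k‖ = ‖k‖ := by
  rw [@norm_eq_sqrt_re_inner ℂ, @norm_eq_sqrt_re_inner ℂ, inner_inclCLM_left, inclCLM_apply_one]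

theorem inner_induced_inclCLM_left (g : G) (k : K) (f : InducedSpace σ) :
    ⟪induced σ g (inclCLM σ k), f⟫_ℂ = ⟪k, f g⟫_ℂ := by
  rw [inner_rep_left, inner_inclCLM_left, induced_apply, inv_inv, mul_one]

theorem inclCLM_rep (h : H) (k : K) : inclCLM σ (σ h k) = induced σ (h : G) (inclCLM σ k) := by
  refine ext_inner_right ℂ fun f => ?_
  have := f.apply_mul 1 h
  rw [one_mul] at this
  rw [inner_induced_inclCLM_left, inner_inclCLM_left, inner_rep_left, this]

theorem evalCLM_one_induced (h : H) (f : InducedSpace σ) :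
    evalCLM σ 1 (induced σ (h : G) f) = σ h (evalCLM σ 1 f) := by
  have := f.apply_mul 1 h⁻¹
  rw [evalCLM_apply, induced_apply, evalCLM_apply, mul_one]
  simpa using this

variable (σ) in
/-- The restriction of the induced representation to the inducing subgroup. -/
abbrev restricted : UnitaryRep H (InducedSpace σ) := (induced σ).comp H.subtype

theorem inclCLM_groupAlgebraHom (a : MonoidAlgebra ℂ H) (k : K) :
    inclCLM σ (groupAlgebraHom σ a k) = groupAlgebraHom (restricted σ) a (inclCLM σ k) :=
  map_groupAlgebraHom (ρ := restricted σ) (inclCLM σ) (fun h k => inclCLM_rep h k) a k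

theorem evalCLM_one_groupAlgebraHom (a : MonoidAlgebra ℂ H) (f : InducedSpace σ) :
    evalCLM σ 1 (groupAlgebraHom (restricted σ) a f) = groupAlgebraHom σ a (evalCLM σ 1 f) :=
  map_groupAlgebraHom (π := restricted σ) (evalCLM σ 1) (fun h f => evalCLM_one_induced h f) a f

theorem groupAlgebraHom_restricted_mem_cstar (a : MonoidAlgebra ℂ H) :
    groupAlgebraHom (restricted σ) a ∈ cstarSubalgebra (induced σ) := by
  obtain ⟨b, hb⟩ := groupAlgebraHom_comp_mem_range (induced σ) H.subtype a
  rw [← hb]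
  exact groupAlgebraHom_mem_cstar _ _

/-- The operator on the induced space that acts as `B` on the functions supported on `H` and
annihilates the functions supported off `H`. -/
def corner (σ : UnitaryRep H K) (B : K →L[ℂ] K) : InducedSpace σ →L[ℂ] InducedSpace σ :=
  inclCLM σ ∘L B ∘L evalCLM σ 1

@[simp]
theorem corner_apply (B : K →L[ℂ] K) (f : InducedSpace σ) :
    corner σ B f = inclCLM σ (B (f 1)) := rfl

/-- A Hilbert space vector of the induced representation vanishing against all translates of the
functions supported on `H` is zero. -/
theorem eq_zero_of_inner_induced_inclCLM {f : InducedSpace σ}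
    (hf : ∀ g k, ⟪induced σ g (inclCLM σ k), f⟫_ℂ = 0) : f = 0 := by
  ext g
  have := hf g (f g)
  rw [inner_induced_inclCLM_left] at this
  simpa using this

theorem eq_top_of_induced_inclCLM_mem [CompleteSpace K]
    {S : Submodule ℂ (InducedSpace σ)} (hSc : IsClosed (S : Set (InducedSpace σ)))
    (hS : ∀ g k, induced σ g (inclCLM σ k) ∈ S) : S = ⊤ := by
  have : CompleteSpace S := hSc.completeSpace_coe
  rw [← Submodule.orthogonal_eq_bot_iff, Submodule.eq_bot_iff]
  intro f hf
  exact eq_zero_of_inner_induced_inclCLM fun g k => (Submodule.mem_orthogonal S f).mp hf _ (hS g k)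

end InducedSpace

/-! ### The spectral gap as a quantitative inequality -/

section SpectralGap

variable {G : Type u} [Group G]

theorem norm_groupAlgebraHom_sub_le {E : Type v} [NormedAddCommGroup E] [InnerProductSpace ℂ E]
    (π : UnitaryRep G E) (a : MonoidAlgebra ℂ G) (ξ : E) :
    ‖groupAlgebraHom π a ξ - groupAlgebraHom (trivial G) a 1 • ξ‖ ≤
      ∑ s ∈ a.coeff.support, ‖a.coeff s‖ * ‖π s ξ - ξ‖ := by
  have h₁ : groupAlgebraHom π a ξ = ∑ s ∈ a.coeff.support, a.coeff s • π s ξ := by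
    simp [groupAlgebraHom, MonoidAlgebra.lift_apply, Finsupp.sum]
  have h₂ : groupAlgebraHom (trivial G) a 1 = ∑ s ∈ a.coeff.support, a.coeff s := by
    simp [groupAlgebraHom, MonoidAlgebra.lift_apply, Finsupp.sum, trivial]
  rw [h₁, h₂, Finset.sum_smul, ← Finset.sum_sub_distrib]
  refine (norm_sum_le _ _).trans (Finset.sum_le_sum fun s _ => ?_)
  rw [← smul_sub, norm_smul]

/-- An `a` whose value `t` in the trivial representation exceeds `‖π_X(a)‖` in modulus keeps
`π_X(a)ξ` at distance at least `c‖ξ‖` from `tξ`. That distance is also at most `∑ |a(s)| ‖sξ - ξ‖`,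
and Cauchy–Schwarz passes to squares. -/
theorem HasSpectralGap.exists_le_sum {X : Type v} [MulAction G X] (h : HasSpectralGap G X) :
    ∃ (S : Finset G) (ε : ℝ), 0 < ε ∧ ∀ ξ : lp (fun _ : X => ℂ) 2,
      ε * ‖ξ‖ ^ 2 ≤ ∑ s ∈ S, ‖permutation G X s ξ - ξ‖ ^ 2 := by
  rw [HasSpectralGap, WeaklyContained] at h
  push Not at h
  obtain ⟨a, ha⟩ := h
  set t := groupAlgebraHom (trivial G) a 1 with ht
  have hnt : ‖groupAlgebraHom (trivial G) a‖ ≤ ‖t‖ := by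
    refine ContinuousLinearMap.opNorm_le_bound _ (norm_nonneg _) fun z => ?_
    have : groupAlgebraHom (trivial G) a z = z • t := by
      rw [ht, ← map_smul, smul_eq_mul, mul_one]
    rw [this, norm_smul, mul_comm]
  set c := ‖t‖ - ‖groupAlgebraHom (permutation G X) a‖ with hc
  have hc0 : 0 < c := by linarith
  set C := ∑ s ∈ a.coeff.support, ‖a.coeff s‖ ^ 2 with hC
  have hC0 : 0 ≤ C := Finset.sum_nonneg fun _ _ => by positivity
  -- The summand `1` keeps the denominator positive without having to show that `a` is non-zero.
  refine ⟨a.coeff.support, c ^ 2 / (C + 1), by positivity, fun ξ => ?_⟩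
  set Q := ∑ s ∈ a.coeff.support, ‖permutation G X s ξ - ξ‖ ^ 2
  have hQ0 : 0 ≤ Q := Finset.sum_nonneg fun _ _ => by positivity
  have h₁ : c * ‖ξ‖ ≤ ∑ s ∈ a.coeff.support, ‖a.coeff s‖ * ‖permutation G X s ξ - ξ‖ := by
    refine le_trans ?_ (norm_groupAlgebraHom_sub_le (permutation G X) a ξ)
    have h₂ := norm_sub_norm_le (t • ξ) (groupAlgebraHom (permutation G X) a ξ)
    rw [norm_sub_rev, norm_smul] at h₂
    have h₃ := (groupAlgebraHom (permutation G X) a).le_opNorm ξ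
    rw [hc, sub_mul]
    linarith
  have h₄ : (c * ‖ξ‖) ^ 2 ≤ C * Q :=
    (pow_le_pow_left₀ (by positivity) h₁ 2).trans (Finset.sum_mul_sq_le_sq_mul_sq _ _ _)
  rw [div_mul_eq_mul_div, div_le_iff₀ (by positivity)]
  nlinarith

end SpectralGap

/-! ### From families of vectors to scalar functions on cosets -/

section Slices

variable {G : Type u} [Group G] {H : Subgroup G}
variable {K : Type v} [NormedAddCommGroup K] [InnerProductSpace ℂ K] {σ : UnitaryRep H K}
variable {M : Type w} [NormedAddCommGroup M] [InnerProductSpace ℂ M]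

/-- The operator norm is at most the Hilbert–Schmidt norm. The former is unchanged by unitaries and
satisfies the triangle inequality; the latter can be summed over cosets to give norms in the induced
space. -/
theorem norm_sq_le_sum_basis {F : Type*} [NormedAddCommGroup F] [NormedSpace ℂ F] {ι : Type*}
    [Fintype ι] (b : OrthonormalBasis ι ℂ M) (A : M →L[ℂ] F) :
    ‖A‖ ^ 2 ≤ ∑ i, ‖A (b i)‖ ^ 2 := by
  set C := ∑ i, ‖A (b i)‖ ^ 2 with hC
  have hC0 : 0 ≤ C := Finset.sum_nonneg fun _ _ => by positivity
  have : ‖A‖ ≤ √C := by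
    refine A.opNorm_le_bound (Real.sqrt_nonneg _) fun x => ?_
    have h₁ : ‖A x‖ ≤ ∑ i, ‖⟪b i, x⟫_ℂ‖ * ‖A (b i)‖ := by
      conv_lhs => rw [← b.sum_repr' x, map_sum]
      refine (norm_sum_le _ _).trans (Finset.sum_le_sum fun i _ => ?_)
      rw [map_smul, norm_smul]
    have h₂ := Finset.sum_mul_sq_le_sq_mul_sq Finset.univ (fun i => ‖⟪b i, x⟫_ℂ‖)
      (fun i => ‖A (b i)‖)
    rw [b.sum_sq_norm_inner_right x] at h₂
    have h₃ : ‖A x‖ ^ 2 ≤ (√C * ‖x‖) ^ 2 := by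
      rw [mul_pow, Real.sq_sqrt hC0, mul_comm]
      exact (pow_le_pow_left₀ (norm_nonneg _) h₁ 2).trans h₂
    exact le_of_sq_le_sq h₃ (by positivity)
  calc ‖A‖ ^ 2 ≤ √C ^ 2 := pow_le_pow_left₀ (norm_nonneg _) this 2
    _ = C := Real.sq_sqrt hC0

namespace InducedSpace

/-- The norm of the value at `x` of a family `T` of vectors of the induced space. -/
def sliceNorm (T : M →L[ℂ] InducedSpace σ) (x : G) : ℝ := ‖evalCLM σ x ∘L T‖

theorem sliceNorm_nonneg (T : M →L[ℂ] InducedSpace σ) (x : G) : 0 ≤ sliceNorm T x := norm_nonneg _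

theorem norm_apply_le_sliceNorm (T : M →L[ℂ] InducedSpace σ) (x : G) (m : M) :
    ‖T m x‖ ≤ sliceNorm T x * ‖m‖ :=
  (evalCLM σ x ∘L T).le_opNorm m

theorem sliceNorm_congr (T : M →L[ℂ] InducedSpace σ) {x y : G} (hxy : (x : G ⧸ H) = y) :
    sliceNorm T x = sliceNorm T y := by
  have key (x y : G) (hxy : (x : G ⧸ H) = y) : sliceNorm T x ≤ sliceNorm T y := by
    refine ContinuousLinearMap.opNorm_le_bound _ (sliceNorm_nonneg _ _) fun m => ?_
    change ‖T m x‖ ≤ _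
    rw [norm_apply_eq (T m) hxy]
    exact norm_apply_le_sliceNorm T y m
  exact le_antisymm (key x y hxy) (key y x hxy.symm)

theorem sliceNorm_sq_le {ι : Type*} [Fintype ι] (b : OrthonormalBasis ι ℂ M)
    (T : M →L[ℂ] InducedSpace σ) (x : G) : sliceNorm T x ^ 2 ≤ ∑ i, ‖T (b i) x‖ ^ 2 :=
  norm_sq_le_sum_basis b _

theorem summable_sliceNorm_sq [FiniteDimensional ℂ M] (T : M →L[ℂ] InducedSpace σ) :
    Summable fun q : G ⧸ H => sliceNorm T q.out ^ 2 :=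
  Summable.of_nonneg_of_le (fun _ => by positivity)
    (fun q => sliceNorm_sq_le (stdOrthonormalBasis ℂ M) T q.out)
    (summable_sum fun i _ => (T (stdOrthonormalBasis ℂ M i)).summable_norm_sq)

/-- Precomposition with a unitary does not change the slice norm. -/
theorem sliceNorm_comp_isometry (T : M →L[ℂ] InducedSpace σ) (U : M ≃ₗᵢ[ℂ] M) (x : G) :
    sliceNorm (T ∘L (U.toContinuousLinearEquiv : M →L[ℂ] M)) x = sliceNorm T x := by
  apply le_antisymm
  · refine ContinuousLinearMap.opNorm_le_bound _ (sliceNorm_nonneg _ _) fun m => ?_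
    have := norm_apply_le_sliceNorm T x (U m)
    rwa [LinearIsometryEquiv.norm_map] at this
  · refine ContinuousLinearMap.opNorm_le_bound _ (sliceNorm_nonneg _ _) fun m => ?_
    have := norm_apply_le_sliceNorm (T ∘L (U.toContinuousLinearEquiv : M →L[ℂ] M)) x (U.symm m)
    rw [LinearIsometryEquiv.norm_map] at this
    simpa using this

theorem abs_sliceNorm_sub_le (T T' : M →L[ℂ] InducedSpace σ) (x : G) :
    |sliceNorm T x - sliceNorm T' x| ≤ sliceNorm (T - T') x := by
  have := abs_norm_sub_norm_le (evalCLM σ x ∘L T) (evalCLM σ x ∘L T')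
  rwa [← ContinuousLinearMap.comp_sub] at this

theorem sliceNorm_comp_induced (T : M →L[ℂ] InducedSpace σ) (g x : G) :
    sliceNorm (toOperators (induced σ) g ∘L T) x = sliceNorm T (g⁻¹ * x) := rfl

/-- The spectral gap inequality for families of vectors supported off `H`. -/
theorem norm_sq_le_of_gap {S : Finset H} {ε : ℝ} (hε : 0 < ε)
    (hS : ∀ ξ : lp (fun _ : cosetsAwayFromBase H => ℂ) 2,
      ε * ‖ξ‖ ^ 2 ≤ ∑ s ∈ S, ‖permutation H (cosetsAwayFromBase H) s ξ - ξ‖ ^ 2)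
    {ι : Type*} [Fintype ι] (b : OrthonormalBasis ι ℂ M) (τ : UnitaryRep H M)
    (T : M →L[ℂ] InducedSpace σ) (hT : ∀ m, T m 1 = 0) {m : M} (hm : ‖m‖ = 1) :
    ε * ‖T m‖ ^ 2 ≤ ∑ s ∈ S, ∑ i, ‖induced σ (s : G) (T (b i)) - T (τ s (b i))‖ ^ 2 := by
  have : FiniteDimensional ℂ M := b.toBasis.finiteDimensional_of_finite
  have hmem : Memℓp (fun q : cosetsAwayFromBase H => (sliceNorm T q.1.out : ℂ)) 2 := by
    rw [memℓp_gen_iff (by norm_num)]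
    have := (summable_sliceNorm_sq T).comp_injective
      (Subtype.val_injective (p := (· ∈ cosetsAwayFromBase H)))
    simpa [Function.comp_def] using! this
  -- The scalar function to which the gap applies; its norm dominates `‖T m‖` since `T` takes values
  -- supported off `H`.
  let ξ : lp (fun _ : cosetsAwayFromBase H => ℂ) 2 := ⟨_, hmem⟩
  have hξ (q : cosetsAwayFromBase H) : ξ q = (sliceNorm T q.1.out : ℂ) := rfl
  have hnorm (η : lp (fun _ : cosetsAwayFromBase H => ℂ) 2) : ‖η‖ ^ 2 = ∑' q, ‖η q‖ ^ 2 := by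
    have := lp.norm_rpow_eq_tsum (p := 2) (by norm_num) η
    simpa using this
  have hsum (η : lp (fun _ : cosetsAwayFromBase H => ℂ) 2) : Summable fun q => ‖η q‖ ^ 2 := by
    have := (memℓp_gen_iff (p := 2) (by norm_num)).mp (lp.memℓp η)
    simpa using this
  have hlow : ‖T m‖ ^ 2 ≤ ‖ξ‖ ^ 2 := by
    rw [norm_sq_eq, hnorm]
    have h₁ : ∑' q : G ⧸ H, ‖T m q.out‖ ^ 2
        = ∑' q : cosetsAwayFromBase H, ‖T m q.1.out‖ ^ 2 := by
      refine (tsum_subtype_eq_of_support_subset (s := (cosetsAwayFromBase H : Set (G ⧸ H)))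
        (f := fun q : G ⧸ H => ‖T m q.out‖ ^ 2) ?_).symm
      intro q hq hq1
      have : ‖T m q.out‖ = ‖T m 1‖ := norm_apply_eq _ (by simpa using hq1)
      rw [hT, norm_zero] at this
      simp [this] at hq
    rw [h₁]
    refine Summable.tsum_le_tsum (fun q => ?_) ?_ (hsum ξ)
    · have := norm_apply_le_sliceNorm T q.1.out m
      rw [hm, mul_one] at this
      rw [hξ, Complex.norm_real, Real.norm_eq_abs, abs_of_nonneg (sliceNorm_nonneg _ _)]
      exact pow_le_pow_left₀ (norm_nonneg _) this 2
    · exact (T m).summable_norm_sq.comp_injective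
        (Subtype.val_injective (p := (· ∈ cosetsAwayFromBase H)))
  refine (mul_le_mul_of_nonneg_left hlow hε.le).trans ((hS ξ).trans ?_)
  refine Finset.sum_le_sum fun s _ => ?_
  -- The failure of `T` to intertwine `τ` with the induced representation at `s`. Its slice norms
  -- dominate the increments of `ξ`, because `T` and `T ∘ τ(s)` have equal slice norms.
  let D : M →L[ℂ] InducedSpace σ := toOperators (induced σ) (s : G) ∘L T -
    T ∘L ((τ s).toContinuousLinearEquiv : M →L[ℂ] M)
  have hD (i : ι) : D (b i) = induced σ (s : G) (T (b i)) - T (τ s (b i)) := rfl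
  simp only [← hD, norm_sq_eq]
  rw [hnorm, ← Summable.tsum_finsetSum fun i _ => (D (b i)).summable_norm_sq]
  have hsD : Summable fun q : G ⧸ H => ∑ i, ‖D (b i) q.out‖ ^ 2 :=
    summable_sum fun i _ => (D (b i)).summable_norm_sq
  refine le_trans (Summable.tsum_le_tsum (fun q => ?_) (hsum _)
    (hsD.comp_injective (Subtype.val_injective (p := (· ∈ cosetsAwayFromBase H)))))
    (Summable.tsum_subtype_le (fun q : G ⧸ H => ∑ i, ‖D (b i) q.out‖ ^ 2)
      (cosetsAwayFromBase H : Set (G ⧸ H)) (fun _ => by positivity) hsD)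
  refine le_trans ?_ (sliceNorm_sq_le b D q.1.out)
  have h₁ : ξ (s⁻¹ • q) = (sliceNorm (toOperators (induced σ) (s : G) ∘L T) q.1.out : ℂ) := by
    rw [hξ, sliceNorm_comp_induced]
    congr 1
    apply sliceNorm_congr
    rw [QuotientGroup.out_eq', ← smul_eq_mul, MulAction.Quotient.coe_smul_out]
    rfl
  have h₂ : ‖(permutation H (cosetsAwayFromBase H) s ξ - ξ) q‖ ≤ sliceNorm D q.1.out := by
    change ‖ξ (s⁻¹ • q) - ξ q‖ ≤ _
    rw [h₁, hξ, ← sliceNorm_comp_isometry T (τ s), ← Complex.ofReal_sub, Complex.norm_real]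
    exact abs_sliceNorm_sub_le _ _ _
  exact pow_le_pow_left₀ (norm_nonneg _) h₂ 2

end InducedSpace

end Slices

/-! ### Separating `σ` from the functions supported off `H` -/

section Corner

variable {G : Type u} [Group G] {H : Subgroup G}
variable {K : Type v} [NormedAddCommGroup K] [InnerProductSpace ℂ K] [FiniteDimensional ℂ K]

/-- There are finitely many elements of the group algebra of `H` that annihilate a vector of `σ`
but are jointly bounded below on the functions supported off `H`. -/
theorem exists_annihilating_family (hH : HasSpectralGapProperty H) {σ : UnitaryRep H K}
    (hσ : σ.IsIrreducible) : ∃ (v : K) (J : Type u) (_ : Fintype J) (d : J → MonoidAlgebra ℂ H)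
      (δ : ℝ), ‖v‖ = 1 ∧ 0 < δ ∧ (∀ j, groupAlgebraHom σ (d j) v = 0) ∧
      ∀ f : InducedSpace σ, f 1 = 0 →
        δ * ‖f‖ ^ 2 ≤ ∑ j, ‖groupAlgebraHom (InducedSpace.restricted σ) (d j) f‖ ^ 2 := by
  have := hσ.1
  obtain ⟨v, hv⟩ := exists_norm_eq K zero_le_one
  obtain ⟨S, ε, hε, hS⟩ := HasSpectralGap.exists_le_sum hH
  let ev : MonoidAlgebra ℂ H →ₗ[ℂ] K :=
    (ContinuousLinearMap.apply ℂ K v : (K →L[ℂ] K) →ₗ[ℂ] K) ∘ₗ (groupAlgebraHom σ).toLinearMap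
  have hev : LinearMap.range ev = ⊤ := by
    refine LinearMap.range_eq_top.mpr fun u => ?_
    exact hσ.exists_groupAlgebraHom_apply_eq (by rintro rfl; simp at hv) u
  -- A linear section of `a ↦ σ(a)v`. It turns any `f` into a linear family `u ↦ ρ(c u) f` indexed
  -- by `K`.
  obtain ⟨c, hc⟩ := ev.exists_rightInverse_of_surjective hev
  have hc (u : K) : groupAlgebraHom σ (c u) v = u := LinearMap.congr_fun hc u
  let b := stdOrthonormalBasis ℂ K
  -- If all these elements nearly kill `f`, then `T u = ρ(c u) f` has `T v` close to `f` and nearly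
  -- intertwines `σ`, which the gap forbids off `H`. The constant comes from `‖f‖² ≤ 2‖f - T v‖² +
  -- 2‖T v‖²` with `‖T v‖² ≤ Q / ε`.
  let d : Option (S × Fin (Module.finrank ℂ K)) → MonoidAlgebra ℂ H
    | none => 1 - c v
    | some (s, i) => MonoidAlgebra.single (s : H) 1 * c (b i) - c (σ s (b i))
  refine ⟨v, Option (S × Fin (Module.finrank ℂ K)), inferInstance, d, (2 + 2 / ε)⁻¹, hv,
    by positivity, ?_, fun f hf => ?_⟩
  · rintro (_ | ⟨s, i⟩)
    · simp [d, hc]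
    · simp [d, hc]
  · let T : K →L[ℂ] InducedSpace σ := LinearMap.toContinuousLinearMap
      ((ContinuousLinearMap.apply ℂ (InducedSpace σ) f : _ →ₗ[ℂ] InducedSpace σ) ∘ₗ
        (groupAlgebraHom (InducedSpace.restricted σ)).toLinearMap ∘ₗ c)
    have hT (u : K) : T u = groupAlgebraHom (InducedSpace.restricted σ) (c u) f := rfl
    have hT1 (u : K) : T u 1 = 0 := by
      have := InducedSpace.evalCLM_one_groupAlgebraHom (c u) f
      simpa [hf] using! this
    have hgap := InducedSpace.norm_sq_le_of_gap hε hS b σ T hT1 hv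
    have h₁ : groupAlgebraHom (InducedSpace.restricted σ) (d none) f = f - T v := by
      simp [d, hT]
    have h₂ (s : S) (i) : groupAlgebraHom (InducedSpace.restricted σ) (d (some (s, i))) f =
        induced σ (s : G) (T (b i)) - T (σ s (b i)) := by
      simp [d, hT]
    rw [Fintype.sum_option, h₁, Fintype.sum_prod_type]
    simp only [h₂]
    rw [Finset.sum_coe_sort S
      (fun s => ∑ i, ‖induced σ (s : G) (T (b i)) - T (σ s (b i))‖ ^ 2)]
    set Q := ∑ s ∈ S, ∑ i, ‖induced σ (s : G) (T (b i)) - T (σ s (b i))‖ ^ 2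
    have hQ : 0 ≤ Q := by positivity
    have h₃ : ‖f‖ ≤ ‖f - T v‖ + ‖T v‖ := by
      simpa using norm_add_le (f - T v) (T v)
    have h₄ : ‖f‖ ^ 2 ≤ 2 * ‖f - T v‖ ^ 2 + 2 * ‖T v‖ ^ 2 := by
      nlinarith [norm_nonneg f, sq_nonneg (‖f - T v‖ - ‖T v‖)]
    have h₅ : ‖T v‖ ^ 2 ≤ Q / ε := by
      rw [le_div_iff₀ hε]
      linarith
    rw [inv_mul_le_iff₀ (by positivity)]
    have h₆ : (2 + 2 / ε) * (‖f - T v‖ ^ 2 + Q) =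
        2 * ‖f - T v‖ ^ 2 + 2 * (Q / ε) + 2 * Q + 2 / ε * ‖f - T v‖ ^ 2 := by ring
    have h₇ : 0 ≤ 2 / ε * ‖f - T v‖ ^ 2 := by positivity
    linarith

end Corner

/-! ### Rank-one operators in the C*-algebra of the induced representation -/

section Corner

/-- With `q = ∑ ‖d_j x‖²` and `y = ∑ d_j* d_j x`, the square expands to `‖x‖² - 2q/m + ‖y‖²/m²`, and
Cauchy–Schwarz gives `‖y‖² ≤ m q`. -/
theorem norm_sub_smul_sum_adjoint_sq_le {E : Type v} [NormedAddCommGroup E]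
    [InnerProductSpace ℂ E] [CompleteSpace E] {J : Type*} [Fintype J] (d : J → E →L[ℂ] E) {m : ℝ}
    (hm : 0 < m) (hd : ∑ j, ‖d j‖ ^ 2 ≤ m) (x : E) :
    ‖x - ((m⁻¹ : ℝ) : ℂ) • ∑ j, star (d j) (d j x)‖ ^ 2 ≤ ‖x‖ ^ 2 - m⁻¹ * ∑ j, ‖d j x‖ ^ 2 := by
  set q := ∑ j, ‖d j x‖ ^ 2 with hq
  have hq0 : 0 ≤ q := by positivity
  set y := ∑ j, star (d j) (d j x) with hy
  have hxy : ⟪x, y⟫_ℂ = (q : ℂ) := by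
    rw [hy, inner_sum, hq, Complex.ofReal_sum]
    refine Finset.sum_congr rfl fun j _ => ?_
    rw [ContinuousLinearMap.star_eq_adjoint, ContinuousLinearMap.adjoint_inner_right,
      inner_self_eq_norm_sq_to_K]
    simp
  have hy2 : ‖y‖ ^ 2 ≤ m * q := by
    have h₁ : ‖y‖ ≤ ∑ j, ‖d j‖ * ‖d j x‖ := by
      refine (norm_sum_le _ _).trans (Finset.sum_le_sum fun j _ => ?_)
      rw [← norm_star (d j)]
      exact (star (d j)).le_opNorm _
    refine (pow_le_pow_left₀ (norm_nonneg _) h₁ 2).trans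
      ((Finset.sum_mul_sq_le_sq_mul_sq _ _ _).trans ?_)
    exact mul_le_mul_of_nonneg_right hd hq0
  rw [@norm_sub_sq ℂ, inner_smul_right, hxy, norm_smul, mul_pow, Complex.norm_real,
    ← Complex.ofReal_mul]
  have h₂ : ‖m⁻¹‖ ^ 2 * ‖y‖ ^ 2 ≤ m⁻¹ * q := by
    rw [Real.norm_eq_abs, sq_abs]
    calc m⁻¹ ^ 2 * ‖y‖ ^ 2 ≤ m⁻¹ ^ 2 * (m * q) := by gcongr
      _ = m⁻¹ * q := by field_simp
  have h₃ : RCLike.re ((m⁻¹ * q : ℝ) : ℂ) = m⁻¹ * q := Complex.ofReal_re _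
  rw [h₃]
  linarith

variable {G : Type u} [Group G] {H : Subgroup G}
variable {K : Type v} [NormedAddCommGroup K] [InnerProductSpace ℂ K] [FiniteDimensional ℂ K]
  [CompleteSpace K]

open InducedSpace

/-- An element of the group algebra of `H` that fixes a vector of `σ`, is a contraction, and is a
strict contraction on the functions supported off `H`. -/
theorem exists_contracting_element (hH : HasSpectralGapProperty H) {σ : UnitaryRep H K}
    (hσ : σ.IsIrreducible) : ∃ (v : K) (a : MonoidAlgebra ℂ H) (r : ℝ), ‖v‖ = 1 ∧
      groupAlgebraHom σ a v = v ∧ 0 ≤ r ∧ r < 1 ∧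
      (∀ f, ‖groupAlgebraHom (restricted σ) a f‖ ≤ ‖f‖) ∧
      ∀ f : InducedSpace σ, f 1 = 0 → ‖groupAlgebraHom (restricted σ) a f‖ ≤ r * ‖f‖ := by
  obtain ⟨v, J, _, d, δ, hv, hδ, hd, hgap⟩ := exists_annihilating_family hH hσ
  choose e he using fun j => exists_groupAlgebraHom_eq_adjoint (restricted σ) (d j)
  -- Large enough for the contraction estimate, and larger than `δ` so that `1 - δ / m` is positive.
  set m : ℝ := 1 + δ + ∑ j, ‖groupAlgebraHom (restricted σ) (d j)‖ ^ 2 with hm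
  have hsum : 0 ≤ ∑ j, ‖groupAlgebraHom (restricted σ) (d j)‖ ^ 2 := by positivity
  have hm0 : 0 < m := by positivity
  -- Each `σ(d j)` kills `v`, so `σ(a)` fixes `v` whatever `σ(e j)` is; only the image of `e j` in
  -- the restricted representation has to be an adjoint.
  let a : MonoidAlgebra ℂ H := 1 - ((m⁻¹ : ℝ) : ℂ) • ∑ j, e j * d j
  have ha (f : InducedSpace σ) : groupAlgebraHom (restricted σ) a f = f - ((m⁻¹ : ℝ) : ℂ) •
      ∑ j, star (groupAlgebraHom (restricted σ) (d j))
        (groupAlgebraHom (restricted σ) (d j) f) := by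
    simp only [a, map_sub, map_one, map_smul, map_sum, map_mul, he]
    simp
  have hle (f : InducedSpace σ) := norm_sub_smul_sum_adjoint_sq_le
    (fun j => groupAlgebraHom (restricted σ) (d j)) hm0 (by linarith) f
  simp only [← ha] at hle
  have hδm : δ / m < 1 := by
    rw [div_lt_one hm0]
    linarith
  refine ⟨v, a, √(1 - δ / m), hv, ?_, Real.sqrt_nonneg _, ?_, fun f => ?_, fun f hf => ?_⟩
  · simp [a, hd]
  · rw [Real.sqrt_lt' one_pos]
    have : 0 < δ / m := by positivity
    linarith
  · refine le_of_sq_le_sq ((hle f).trans ?_) (norm_nonneg _)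
    have : 0 ≤ m⁻¹ * ∑ j, ‖groupAlgebraHom (restricted σ) (d j) f‖ ^ 2 := by positivity
    linarith
  · refine le_of_sq_le_sq ((hle f).trans ?_) (by positivity)
    rw [mul_pow, Real.sq_sqrt (by linarith)]
    have := mul_le_mul_of_nonneg_left (hgap f hf) (inv_nonneg.mpr hm0.le)
    have h₂ : (1 - δ / m) * ‖f‖ ^ 2 = ‖f‖ ^ 2 - m⁻¹ * (δ * ‖f‖ ^ 2) := by ring
    linarith

/-- Powers of the contracting element decay geometrically off `H`, while on `K` they form a bounded
sequence of operators on a finite-dimensional space. `B` is a subsequential limit there; it is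
non-zero because all powers fix `v`. -/
theorem exists_corner_mem_cstar (hH : HasSpectralGapProperty H) {σ : UnitaryRep H K}
    (hσ : σ.IsIrreducible) : ∃ (v : K) (B : K →L[ℂ] K), ‖v‖ = 1 ∧ B v = v ∧
      corner σ B ∈ cstarSubalgebra (induced σ) := by
  obtain ⟨v, a, r, hv, hav, hr0, hr1, hcontr, hstrict⟩ := exists_contracting_element hH hσ
  let ρ := groupAlgebraHom (restricted σ)
  have hpow (n : ℕ) (f : InducedSpace σ) : ‖ρ (a ^ n) f‖ ≤ ‖f‖ := by
    induction n with
    | zero => simp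
    | succ n ih =>
      rw [pow_succ', map_mul]
      exact (hcontr _).trans ih
  have hpow_strict (n : ℕ) (f : InducedSpace σ) (hf : f 1 = 0) :
      ‖ρ (a ^ n) f‖ ≤ r ^ n * ‖f‖ := by
    induction n with
    | zero => simp
    | succ n ih =>
      rw [pow_succ', map_mul, pow_succ', mul_assoc]
      refine (hstrict _ ?_).trans (mul_le_mul_of_nonneg_left ih hr0)
      have := evalCLM_one_groupAlgebraHom (a ^ n) f
      rwa [evalCLM_apply, evalCLM_apply, hf, map_zero] at this
  have hbdd (n : ℕ) : groupAlgebraHom σ (a ^ n) ∈ Metric.closedBall (0 : K →L[ℂ] K) 1 := by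
    rw [mem_closedBall_zero_iff]
    refine ContinuousLinearMap.opNorm_le_bound _ zero_le_one fun k => ?_
    rw [one_mul, ← norm_inclCLM (σ := σ), inclCLM_groupAlgebraHom, ← norm_inclCLM (σ := σ) k]
    exact hpow n _
  have : ProperSpace (K →L[ℂ] K) := FiniteDimensional.proper ℂ _
  obtain ⟨B, -, φ, hφ, hB⟩ := tendsto_subseq_of_bounded Metric.isBounded_closedBall hbdd
  refine ⟨v, B, hv, ?_, ?_⟩
  · have h₁ : Tendsto (fun n => groupAlgebraHom σ (a ^ φ n) v) atTop (𝓝 (B v)) :=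
      ((ContinuousLinearMap.apply ℂ K v).continuous.tendsto B).comp hB
    have h₂ (n : ℕ) : groupAlgebraHom σ (a ^ n) v = v := by
      induction n with
      | zero => simp
      | succ n ih => rw [pow_succ, map_mul, mul_apply_eq_comp, hav, ih]
    simp only [h₂] at h₁
    exact tendsto_nhds_unique h₁ tendsto_const_nhds
  · refine (isClosed_cstarSubalgebra (induced σ)).mem_of_tendsto
      (f := fun n => ρ (a ^ φ n)) (b := atTop) ?_
      (Eventually.of_forall fun n => groupAlgebraHom_restricted_mem_cstar _)
    rw [tendsto_iff_norm_sub_tendsto_zero]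
    have hlim : Tendsto (fun n => r ^ φ n * 2 + ‖groupAlgebraHom σ (a ^ φ n) - B‖) atTop
        (𝓝 (0 * 2 + 0)) :=
      (((tendsto_pow_atTop_nhds_zero_of_lt_one hr0 hr1).comp hφ.tendsto_atTop).mul_const 2).add
        (tendsto_iff_norm_sub_tendsto_zero.mp hB)
    rw [zero_mul, add_zero] at hlim
    refine squeeze_zero (fun _ => norm_nonneg _) (fun n => ?_) hlim
    refine ContinuousLinearMap.opNorm_le_bound _ (by positivity) fun f => ?_
    -- Split `f` into its part off `H`, of norm at most `2‖f‖`, and its part on `H`.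
    have h₁ : (ρ (a ^ φ n) - corner σ B) f = ρ (a ^ φ n) (f - inclCLM σ (f 1)) +
        inclCLM σ ((groupAlgebraHom σ (a ^ φ n) - B) (f 1)) := by
      rw [_root_.sub_apply, _root_.sub_apply, map_sub, map_sub, inclCLM_groupAlgebraHom, corner_apply]
      abel
    rw [h₁, add_mul]
    refine (norm_add_le _ _).trans (add_le_add ?_ ?_)
    · refine (hpow_strict _ _ (by simp)).trans ?_
      rw [mul_assoc]
      refine mul_le_mul_of_nonneg_left ?_ (by positivity)
      have := norm_sub_le f (inclCLM σ (f 1))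
      rw [norm_inclCLM] at this
      linarith [norm_apply_le f 1]
    · rw [norm_inclCLM]
      exact (ContinuousLinearMap.le_opNorm _ _).trans
        (mul_le_mul_of_nonneg_left (norm_apply_le f 1) (norm_nonneg _))

/-- By Burnside, multiply `B` on the left by `|u⟩⟨v|` and on the right by `|v⟩⟨w|`; since `B v = v`
and `‖v‖ = 1`, the product is `|u⟩⟨w|`. -/
theorem corner_mem_cstar (hH : HasSpectralGapProperty H) {σ : UnitaryRep H K}
    (hσ : σ.IsIrreducible) (u w : K) :
    corner σ (InnerProductSpace.rankOne ℂ u w) ∈ cstarSubalgebra (induced σ) := by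
  obtain ⟨v, B, hv, hB, hmem⟩ := exists_corner_mem_cstar hH hσ
  obtain ⟨a, ha⟩ := hσ.groupAlgebraHom_surjective (InnerProductSpace.rankOne ℂ u v)
  obtain ⟨b, hb⟩ := hσ.groupAlgebraHom_surjective (InnerProductSpace.rankOne ℂ v w)
  have : corner σ (InnerProductSpace.rankOne ℂ u w) = groupAlgebraHom (restricted σ) a *
      corner σ B * groupAlgebraHom (restricted σ) b := by
    ext1 f
    have h₁ := evalCLM_one_groupAlgebraHom b f
    rw [evalCLM_apply, evalCLM_apply, hb] at h₁
    rw [mul_apply_eq_comp, mul_apply_eq_comp, corner_apply, corner_apply,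
      ← inclCLM_groupAlgebraHom, h₁, ha]
    simp [hB, hv]
  rw [this]
  exact mul_mem (mul_mem (groupAlgebraHom_restricted_mem_cstar a) hmem)
    (groupAlgebraHom_restricted_mem_cstar b)

/-- A closed invariant `S` meets `K` in `0` or contains `K`. In the first case corners send `S` into
`S ∩ K = 0`, so all elements of `S` vanish at `1` and, by translation, everywhere. In the second
case `S` contains the total set of translates of `K`. -/
theorem IsIrreducible.induced (hH : HasSpectralGapProperty H) {σ : UnitaryRep H K}
    (hσ : σ.IsIrreducible) : (induced σ).IsIrreducible := by
  have hinj : Function.Injective (inclCLM σ) := fun x y h => by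
    simpa using congrArg (fun f : InducedSpace σ => f 1) h
  have := hσ.1
  refine ⟨hinj.nontrivial, fun S hSc hS => ?_⟩
  let N : Submodule ℂ K := S.comap (inclCLM σ : K →ₗ[ℂ] InducedSpace σ)
  have hmemN (k : K) : k ∈ N ↔ inclCLM σ k ∈ S := Iff.rfl
  rcases hσ.2 N N.closed_of_finiteDimensional fun h k hk => by
    rw [hmemN, inclCLM_rep]
    exact hS _ _ hk with hN | hN
  · left
    rw [Submodule.eq_bot_iff]
    intro f hf
    have key (f : InducedSpace σ) (hf : f ∈ S) : f 1 = 0 := by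
      have h₁ (w u : K) : (⟪w, f 1⟫_ℂ • u) = 0 := by
        have := cstar_apply_mem hSc hS (corner_mem_cstar hH hσ u w) hf
        rw [corner_apply, ← hmemN, hN] at this
        simpa using this
      have h₂ := h₁ (f 1) (f 1)
      simpa using h₂
    ext g
    have := key _ (hS g⁻¹ f hf)
    rwa [induced_apply, inv_inv, mul_one] at this
  · right
    refine eq_top_of_induced_inclCLM_mem hSc fun g k => hS g _ ?_
    rw [← hmemN, hN]
    exact Submodule.mem_top

/-- Translates of corners give the operators `|x⟩⟨y|` with `x` and `y` in translates of `K`; these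
are total, and membership is a closed linear condition in each variable separately. -/
theorem rankOne_mem_cstar (hH : HasSpectralGapProperty H) {σ : UnitaryRep H K}
    (hσ : σ.IsIrreducible) (x y : InducedSpace σ) :
    InnerProductSpace.rankOne ℂ x y ∈ cstarSubalgebra (induced σ) := by
  have hop (g : G) : toOperators (induced σ) g ∈ cstarSubalgebra (induced σ) := by
    simpa using groupAlgebraHom_mem_cstar (induced σ) (MonoidAlgebra.single g 1)
  have hbase (g g' : G) (k k' : K) : InnerProductSpace.rankOne ℂ (induced σ g (inclCLM σ k))
      (induced σ g' (inclCLM σ k')) ∈ cstarSubalgebra (induced σ) := by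
    have : InnerProductSpace.rankOne ℂ (induced σ g (inclCLM σ k)) (induced σ g' (inclCLM σ k')) =
        toOperators (induced σ) g * corner σ (InnerProductSpace.rankOne ℂ k k') *
          toOperators (induced σ) g'⁻¹ := by
      ext1 f
      change ⟪induced σ g' (inclCLM σ k'), f⟫_ℂ • induced σ g (inclCLM σ k) =
        induced σ g (corner σ (InnerProductSpace.rankOne ℂ k k') (induced σ g'⁻¹ f))
      rw [inner_induced_inclCLM_left, corner_apply, InnerProductSpace.rankOne_apply, map_smul,
        map_smul, induced_apply, inv_inv, mul_one]
    rw [this]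
    exact mul_mem (mul_mem (hop g) (corner_mem_cstar hH hσ k k')) (hop _)
  have hleft (x : InducedSpace σ) (g' : G) (k' : K) : InnerProductSpace.rankOne ℂ x
      (induced σ g' (inclCLM σ k')) ∈ cstarSubalgebra (induced σ) := by
    let R : InducedSpace σ →L[ℂ] (InducedSpace σ →L[ℂ] InducedSpace σ) :=
      (InnerProductSpace.rankOne ℂ).flip (induced σ g' (inclCLM σ k'))
    let S : Submodule ℂ (InducedSpace σ) := (cstarSubalgebra (induced σ)).toSubmodule.comap
      (R : InducedSpace σ →ₗ[ℂ] (InducedSpace σ →L[ℂ] InducedSpace σ))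
    have : S = ⊤ := eq_top_of_induced_inclCLM_mem
      ((isClosed_cstarSubalgebra (induced σ)).preimage R.continuous) fun g k => hbase g g' k k'
    exact (this ▸ Submodule.mem_top : x ∈ S)
  let R := InnerProductSpace.rankOne ℂ (F := InducedSpace σ) x
  -- Built by hand because `rankOne` is conjugate-linear in its second argument.
  let S : Submodule ℂ (InducedSpace σ) :=
    { carrier := {y | R y ∈ cstarSubalgebra (induced σ)}
      add_mem' := fun ha hb => by simpa using add_mem ha hb
      zero_mem' := by simp [zero_mem]
      smul_mem' := fun c y hy => by
        change R (c • y) ∈ cstarSubalgebra (induced σ)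
        rw [map_smulₛₗ]
        exact Subalgebra.smul_mem _ hy _ }
  have : S = ⊤ := eq_top_of_induced_inclCLM_mem
    ((isClosed_cstarSubalgebra (induced σ)).preimage R.continuous) fun g k => hleft x g k
  exact (this ▸ Submodule.mem_top : y ∈ S)

end Corner

/-! ### Compact operators, monotone limits and the operator trace -/

section Operators

variable {E : Type v} [NormedAddCommGroup E] [InnerProductSpace ℂ E] [CompleteSpace E]

/-- A closed space of operators that contains the operators of rank one contains the compact
operators. -/
theorem mem_of_isCompactOperator {A : Submodule ℂ (E →L[ℂ] E)}
    (hA : IsClosed (A : Set (E →L[ℂ] E)))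
    (h : ∀ x y : E, InnerProductSpace.rankOne ℂ x y ∈ A) {T : E →L[ℂ] E}
    (hT : IsCompactOperator T) : T ∈ A := by
  rw [← SetLike.mem_coe, ← hA.closure_eq, Metric.mem_closure_iff]
  intro ε hε
  have hcpt : IsCompact (closure (T '' Metric.closedBall 0 1)) :=
    IsCompactOperator.isCompact_closure_image_closedBall (f := (T : E →ₗ[ℂ] E)) hT 1
  obtain ⟨t, ht, hcover⟩ := Metric.totallyBounded_iff.mp hcpt.totallyBounded (ε / 2) (by positivity)
  -- The span of the centres of an `ε / 2`-net of the image of the unit ball: projecting onto it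
  -- moves `T x` by at most `ε / 2`, and the projected operator has finite rank.
  let V := Submodule.span ℂ t
  have : FiniteDimensional ℂ V := FiniteDimensional.span_of_finite ℂ ht
  refine ⟨V.starProjection ∘L T, ?_, ?_⟩
  · rw [(stdOrthonormalBasis ℂ V).starProjection_eq_sum_rankOne, SetLike.mem_coe]
    have (x y : E) : InnerProductSpace.rankOne ℂ x y ∘L T =
        InnerProductSpace.rankOne ℂ x (star T y) := by
      ext z
      simp [ContinuousLinearMap.star_eq_adjoint, ContinuousLinearMap.adjoint_inner_left]
    rw [ContinuousLinearMap.finsetSum_comp]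
    exact sum_mem fun i _ => by rw [this]; exact h _ _
  · refine lt_of_le_of_lt ?_ (half_lt_self hε)
    rw [dist_eq_norm]
    refine ContinuousLinearMap.opNorm_le_of_unit_norm (by positivity) fun x hx => ?_
    have hx' : T x ∈ closure (T '' Metric.closedBall 0 1) :=
      subset_closure ⟨x, by simp [hx], rfl⟩
    obtain ⟨y, hy, hxy⟩ := Set.mem_iUnion₂.mp (hcover hx')
    rw [Metric.mem_ball, dist_eq_norm] at hxy
    refine le_trans ?_ hxy.le
    change ‖T x - V.starProjection (T x)‖ ≤ _
    rw [Submodule.starProjection_minimal]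
    exact ciInf_le ⟨0, Set.forall_mem_range.mpr fun _ => norm_nonneg _⟩
      (⟨y, Submodule.subset_span hy⟩ : V)

theorem norm_apply_sq_le_of_nonneg {c : E →L[ℂ] E} (hc : 0 ≤ c) (x : E) :
    ‖c x‖ ^ 2 ≤ ‖c‖ * RCLike.re ⟪x, c x⟫_ℂ := by
  obtain ⟨s, rfl⟩ := CStarAlgebra.nonneg_iff_eq_star_mul_self.mp hc
  have h₁ : RCLike.re ⟪x, (star s * s) x⟫_ℂ = ‖s x‖ ^ 2 := by
    rw [mul_apply_eq_comp, ContinuousLinearMap.star_eq_adjoint,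
      ContinuousLinearMap.adjoint_inner_right, inner_self_eq_norm_sq]
  rw [h₁, CStarRing.norm_star_mul_self, ← sq, ← mul_pow]
  refine pow_le_pow_left₀ (norm_nonneg _) ?_ 2
  rw [← norm_star s]
  exact (star s).le_opNorm _

theorem re_inner_le_of_le {E : Type v} [NormedAddCommGroup E] [InnerProductSpace ℂ E] {a b : E →L[ℂ] E} (h : a ≤ b) (x : E) :
    RCLike.re ⟪x, a x⟫_ℂ ≤ RCLike.re ⟪x, b x⟫_ℂ := by
  have := ((ContinuousLinearMap.le_def a b).mp h).re_inner_nonneg_right x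
  rw [sub_apply, inner_sub_right, map_sub] at this
  linarith

theorem re_inner_nonneg {E : Type v} [NormedAddCommGroup E] [InnerProductSpace ℂ E] {a : E →L[ℂ] E} (h : 0 ≤ a) (x : E) : 0 ≤ RCLike.re ⟪x, a x⟫_ℂ := by
  simpa using re_inner_le_of_le h x

theorem isPositive_of_tendsto {E : Type v} [NormedAddCommGroup E] [InnerProductSpace ℂ E]
    {ι : Type*} {l : Filter ι} [l.NeBot] {T : ι → E →L[ℂ] E} {S : E →L[ℂ] E}
    (h : ∀ ξ, Tendsto (fun i => T i ξ) l (𝓝 (S ξ))) (hT : ∀ᶠ i in l, (T i).IsPositive) :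
    S.IsPositive := by
  rw [ContinuousLinearMap.isPositive_iff_complex]
  intro ξ
  have hclosed : IsClosed {z : ℂ | ((RCLike.re z : ℝ) : ℂ) = z ∧ 0 ≤ RCLike.re z} :=
    (isClosed_eq (Complex.continuous_ofReal.comp Complex.continuous_re) continuous_id).inter
      (isClosed_le continuous_const Complex.continuous_re)
  refine hclosed.mem_of_tendsto ((h ξ).inner tendsto_const_nhds) ?_
  filter_upwards [hT] with i hi
  exact (ContinuousLinearMap.isPositive_iff_complex _).mp hi ξ

/-- Bounded increasing nets of operators converge strongly to their supremum. -/
theorem tendsto_apply_of_isLUB {D : Set (E →L[ℂ] E)} (hne : D.Nonempty) (hpos : ∀ d ∈ D, 0 ≤ d)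
    (hdir : DirectedOn (· ≤ ·) D) {x : E →L[ℂ] E} (hx : IsLUB D x) (ξ : E) :
    Tendsto (fun d : D => (d : E →L[ℂ] E) ξ) atTop (𝓝 (x ξ)) := by
  have : Nonempty D := hne.to_subtype
  have : IsDirectedOrder D := ⟨fun a b => by
    obtain ⟨c, hc, hac, hbc⟩ := hdir a a.2 b b.2
    exact ⟨⟨c, hc⟩, hac, hbc⟩⟩
  have hle (d : D) : (d : E →L[ℂ] E) ≤ x := hx.1 d.2
  have hlim (ξ : E) : ∃ y, Tendsto (fun d : D => (d : E →L[ℂ] E) ξ) atTop (𝓝 y) := by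
    let q : D → ℝ := fun d => RCLike.re ⟪ξ, (d : E →L[ℂ] E) ξ⟫_ℂ
    have hq : Monotone q := fun a b hab => re_inner_le_of_le hab ξ
    have hbdd : BddAbove (Set.range q) :=
      ⟨RCLike.re ⟪ξ, x ξ⟫_ℂ, Set.forall_mem_range.mpr fun d => re_inner_le_of_le (hle d) ξ⟩
    -- Since `0 ≤ b - a ≤ x`, the quadratic form of the increment controls its action on `ξ`, so the
    -- net inherits the Cauchy property from a bounded monotone net of reals.
    have key (a b : D) (hab : a ≤ b) :
        ‖(b : E →L[ℂ] E) ξ - (a : E →L[ℂ] E) ξ‖ ^ 2 ≤ ‖x‖ * (q b - q a) := by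
      have h0 : 0 ≤ (b : E →L[ℂ] E) - a := sub_nonneg.mpr hab
      have h₁ := norm_apply_sq_le_of_nonneg h0 ξ
      rw [sub_apply, inner_sub_right, map_sub] at h₁
      refine h₁.trans (mul_le_mul_of_nonneg_right ?_ (sub_nonneg.mpr (hq hab)))
      refine CStarAlgebra.norm_le_norm_of_nonneg_of_le h0 ?_
      exact (sub_le_self _ (hpos a a.2)).trans (hle b)
    apply CompleteSpace.complete
    rw [Metric.cauchy_iff]
    refine ⟨inferInstance, fun ε hε => ?_⟩
    have hη : 0 < (ε / 2) ^ 2 / (‖x‖ + 1) := by positivity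
    obtain ⟨N, hN⟩ := exists_lt_of_lt_ciSup (sub_lt_self (⨆ d, q d) hη)
    have hN' (d : D) (hd : N ≤ d) :
        dist ((d : E →L[ℂ] E) ξ) ((N : E →L[ℂ] E) ξ) < ε / 2 := by
      rw [dist_eq_norm]
      refine lt_of_pow_lt_pow_left₀ 2 (by positivity) ((key N d hd).trans_lt ?_)
      have h₁ : q d - q N < (ε / 2) ^ 2 / (‖x‖ + 1) := by linarith [le_ciSup hbdd d]
      have h₂ : 0 ≤ q d - q N := sub_nonneg.mpr (hq hd)
      rw [lt_div_iff₀ (by positivity)] at h₁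
      nlinarith [norm_nonneg x]
    refine ⟨(fun d : D => (d : E →L[ℂ] E) ξ) '' Set.Ici N, image_mem_map (Ici_mem_atTop N), ?_⟩
    rintro _ ⟨a, ha, rfl⟩ _ ⟨b, hb, rfl⟩
    calc dist ((a : E →L[ℂ] E) ξ) ((b : E →L[ℂ] E) ξ)
        ≤ dist ((a : E →L[ℂ] E) ξ) ((N : E →L[ℂ] E) ξ) +
          dist ((b : E →L[ℂ] E) ξ) ((N : E →L[ℂ] E) ξ) := dist_triangle_right _ _ _
      _ < ε / 2 + ε / 2 := add_lt_add (hN' a ha) (hN' b hb)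
      _ = ε := add_halves ε
  choose f hf using hlim
  let y : E →L[ℂ] E := ContinuousLinearMap.ofTendstoOfBoundedRange f
    (fun d : D => (d : E →L[ℂ] E)) (tendsto_pi_nhds.mpr hf)
    (isBounded_iff_forall_norm_le.mpr ⟨‖x‖, Set.forall_mem_range.mpr fun d =>
      CStarAlgebra.norm_le_norm_of_nonneg_of_le (hpos d d.2) (hle d)⟩)
  have hy (ξ : E) : Tendsto (fun d : D => (d : E →L[ℂ] E) ξ) atTop (𝓝 (y ξ)) := hf ξ
  -- Positivity survives strong limits, so `y` is an upper bound of `D` lying below `x`.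
  have hxy : x = y := by
    apply le_antisymm
    · refine hx.2 fun a ha => isPositive_of_tendsto (l := atTop)
        (T := fun d : D => (d : E →L[ℂ] E) - a) (fun ξ => (hy ξ).sub_const (a ξ)) ?_
      filter_upwards [Ici_mem_atTop (⟨a, ha⟩ : D)] with d hd
      exact hd
    · exact isPositive_of_tendsto (l := atTop) (T := fun d : D => x - (d : E →L[ℂ] E))
        (fun ξ => (hy ξ).const_sub (x ξ)) (Eventually.of_forall hle)
  rw [hxy]
  exact hy ξ

variable {ι : Type*} (b : HilbertBasis ι ℂ E)

theorem ofReal_norm_sq_eq_tsum {E : Type v} [NormedAddCommGroup E] [InnerProductSpace ℂ E]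
    (b : HilbertBasis ι ℂ E) (y : E) :
    ENNReal.ofReal (‖y‖ ^ 2) = ∑' j, ENNReal.ofReal (‖⟪b j, y⟫_ℂ‖ ^ 2) := by
  have h := Complex.hasSum_re (b.hasSum_inner_mul_inner y y)
  have h₁ (j : ι) : (⟪y, b j⟫_ℂ * ⟪b j, y⟫_ℂ).re = ‖⟪b j, y⟫_ℂ‖ ^ 2 := by
    rw [← inner_conj_symm, ← Complex.normSq_eq_conj_mul_self, Complex.ofReal_re,
      Complex.normSq_eq_norm_sq]
  have h₂ : (⟪y, y⟫_ℂ).re = ‖y‖ ^ 2 := inner_self_eq_norm_sq (𝕜 := ℂ) y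
  simp only [h₁, h₂] at h
  rw [← h.tsum_eq, ENNReal.ofReal_tsum_of_nonneg (fun _ => by positivity) h.summable]

/-- The canonical trace on the positive operators. -/
def opTrace {E : Type v} [NormedAddCommGroup E] [InnerProductSpace ℂ E]
    (b : HilbertBasis ι ℂ E) (x : E →L[ℂ] E) : ℝ≥0∞ :=
  ∑' i, ENNReal.ofReal (RCLike.re ⟪b i, x (b i)⟫_ℂ)

theorem opTrace_star_mul_self (x : E →L[ℂ] E) :
    opTrace b (star x * x) = ∑' i, ∑' j, ENNReal.ofReal (‖⟪b j, x (b i)⟫_ℂ‖ ^ 2) := by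
  refine tsum_congr fun i => ?_
  rw [← ofReal_norm_sq_eq_tsum, mul_apply_eq_comp, ContinuousLinearMap.star_eq_adjoint,
    ContinuousLinearMap.adjoint_inner_right, inner_self_eq_norm_sq]

theorem opTrace_rankOne {E : Type v} [NormedAddCommGroup E] [InnerProductSpace ℂ E]
    (b : HilbertBasis ι ℂ E) (x : E) :
    opTrace b (InnerProductSpace.rankOne ℂ x x) = ENNReal.ofReal (‖x‖ ^ 2) := by
  rw [ofReal_norm_sq_eq_tsum b]
  refine tsum_congr fun i => ?_
  rw [InnerProductSpace.rankOne_apply, inner_smul_right, ← inner_conj_symm,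
    ← Complex.normSq_eq_conj_mul_self, Complex.normSq_eq_norm_sq]
  congr 1

/-- Traciality is the exchange of the double sum of squared matrix coefficients. Normality is strong
convergence to the supremum, after which suprema over `D` commute with finite sums by monotonicity.
-/
theorem isFaithfulNormalTrace_opTrace (W : Set (E →L[ℂ] E)) :
    IsFaithfulNormalTrace W (opTrace b) where
  map_add x _ y _ hx hy := by
    rw [opTrace, opTrace, opTrace, ← ENNReal.tsum_add]
    refine tsum_congr fun i => ?_
    rw [add_apply, inner_add_right, map_add,
      ENNReal.ofReal_add (re_inner_nonneg hx _) (re_inner_nonneg hy _)]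
  map_smul x _ hx c := by
    rw [opTrace, opTrace, ← ENNReal.tsum_mul_left]
    refine tsum_congr fun i => ?_
    have : RCLike.re ⟪b i, (((c : ℝ) : ℂ) • x) (b i)⟫_ℂ = c * RCLike.re ⟪b i, x (b i)⟫_ℂ := by
      rw [smul_apply, inner_smul_right]
      exact Complex.re_ofReal_mul _ _
    rw [this, ENNReal.ofReal_mul c.coe_nonneg, ENNReal.ofReal_coe_nnreal]
  tracial x _ := by
    have h := opTrace_star_mul_self b (star x)
    rw [star_star] at h
    rw [h, opTrace_star_mul_self, ENNReal.tsum_comm]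
    refine tsum_congr fun i => tsum_congr fun j => ?_
    rw [ContinuousLinearMap.star_eq_adjoint, ContinuousLinearMap.adjoint_inner_right,
      norm_inner_symm]
  faithful x _ hx h0 := by
    rw [opTrace, ENNReal.tsum_eq_zero] at h0
    have hb (i : ι) : x (b i) = 0 := by
      have h₁ := norm_apply_sq_le_of_nonneg hx (b i)
      have h₂ := ENNReal.ofReal_eq_zero.mp (h0 i)
      rw [le_antisymm h₂ (re_inner_nonneg hx _), mul_zero] at h₁
      exact norm_eq_zero.mp (pow_eq_zero_iff two_ne_zero |>.mp (le_antisymm h₁ (by positivity)))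
    ext ξ
    have h₁ := (b.hasSum_repr ξ).mapL x
    simp only [map_smul, hb, smul_zero] at h₁
    simpa using h₁.unique hasSum_zero
  normal D _ hne hpos hdir x _ hx := by
    have : Nonempty D := hne.to_subtype
    have : IsDirectedOrder D := ⟨fun a b => by
      obtain ⟨c, hc, hac, hbc⟩ := hdir a a.2 b b.2
      exact ⟨⟨c, hc⟩, hac, hbc⟩⟩
    have hmono (ξ : E) : Monotone fun d : D =>
        ENNReal.ofReal (RCLike.re ⟪ξ, (d : E →L[ℂ] E) ξ⟫_ℂ) :=
      fun a b hab => ENNReal.ofReal_le_ofReal (re_inner_le_of_le hab ξ)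
    have hsup (ξ : E) : ENNReal.ofReal (RCLike.re ⟪ξ, x ξ⟫_ℂ) =
        ⨆ d : D, ENNReal.ofReal (RCLike.re ⟪ξ, (d : E →L[ℂ] E) ξ⟫_ℂ) := by
      refine tendsto_nhds_unique (ENNReal.tendsto_ofReal ?_) (tendsto_atTop_iSup (hmono ξ))
      exact (RCLike.continuous_re.tendsto _).comp
        (tendsto_const_nhds.inner (tendsto_apply_of_isLUB hne hpos hdir hx ξ))
    rw [iSup_subtype']
    simp only [opTrace, hsup, ENNReal.tsum_eq_iSup_sum]
    rw [iSup_comm]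
    refine iSup_congr fun s => ?_
    exact ENNReal.finsetSum_iSup_of_monotone fun i => hmono (b i)

end Operators

/-! ### Traceability from rank-one operators -/

section Traceable

variable {G : Type u} [Group G]
variable {E : Type v} [NormedAddCommGroup E] [InnerProductSpace ℂ E] [CompleteSpace E]

theorem containsCompacts_of_rankOne_mem {π : UnitaryRep G E}
    (h : ∀ x y : E, InnerProductSpace.rankOne ℂ x y ∈ cstarSubalgebra π) : π.ContainsCompacts :=
  fun _ hT => mem_cstarSubalgebra.mp <| mem_of_isCompactOperator
    (A := (cstarSubalgebra π).toSubmodule) (isClosed_cstarSubalgebra π) h hT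

theorem isTraceable_of_rankOne_mem [Nontrivial E] {π : UnitaryRep G E}
    (h : ∀ x y : E, InnerProductSpace.rankOne ℂ x y ∈ cstarSubalgebra π) : π.IsTraceable := by
  obtain ⟨e, he⟩ := exists_norm_eq E zero_le_one
  obtain ⟨w, b, -⟩ := exists_hilbertBasis ℂ E
  refine ⟨⟨inferInstance, fun T _ hT => ⟨⟪e, T e⟫_ℂ, ?_⟩⟩, opTrace b,
    isFaithfulNormalTrace_opTrace b _, InnerProductSpace.rankOne ℂ e e,
    mem_cstarSubalgebra.mp (h e e), ?_, ?_, ?_⟩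
  -- Applying `T |x⟩⟨e| = |x⟩⟨e| T` to the unit vector `e` gives `T x = ⟪e, T e⟫ x`.
  · ext x
    have h₁ := hT (InnerProductSpace.rankOne ℂ x e)
      (subset_closure ⟨_, mem_cstarSubalgebra.mp (h x e), rfl⟩)
    have h₂ := congrArg (fun S : E →L[ℂ] E => S e) h₁
    simpa [he] using h₂
  · rw [ContinuousLinearMap.nonneg_iff_isPositive]
    exact InnerProductSpace.isPositive_rankOne_self e
  · rw [opTrace_rankOne, he]
    simp
  · rw [opTrace_rankOne]
    exact ENNReal.ofReal_lt_top

end Traceable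

/-! ### Intertwiners and unitary equivalence -/

section Intertwiners

variable {G : Type u} [Group G]
variable {E : Type v} [NormedAddCommGroup E] [InnerProductSpace ℂ E]
variable {F : Type w} [NormedAddCommGroup F] [InnerProductSpace ℂ F]

theorem exists_isometric_intertwiner {π : UnitaryRep G E} {ρ : UnitaryRep G F} (T : E →ₗ[ℂ] F)
    (hT : ∀ g x, T (π g x) = ρ g (T x)) {κ : ℝ} (hκ : 0 < κ)
    (hnorm : ∀ x, ‖T x‖ ^ 2 = κ * ‖x‖ ^ 2) :
    ∃ V : E →ₗᵢ[ℂ] F, ∀ g x, V (π g x) = ρ g (V x) := by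
  refine ⟨⟨((√κ)⁻¹ : ℂ) • T, fun x => ?_⟩, fun g x => ?_⟩
  · rw [← sq_eq_sq₀ (norm_nonneg _) (norm_nonneg _)]
    change ‖((√κ)⁻¹ : ℂ) • T x‖ ^ 2 = _
    rw [norm_smul, mul_pow, hnorm, norm_inv, Complex.norm_real, Real.norm_eq_abs, inv_pow, sq_abs,
      Real.sq_sqrt hκ.le, inv_mul_cancel_left₀ hκ.ne']
  · change ((√κ)⁻¹ : ℂ) • T (π g x) = ρ g (((√κ)⁻¹ : ℂ) • T x)
    rw [hT, map_smul]

theorem UnitarilyEquivalent.symm {π : UnitaryRep G E} {ρ : UnitaryRep G F}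
    (h : π.UnitarilyEquivalent ρ) : ρ.UnitarilyEquivalent π := by
  obtain ⟨U, hU⟩ := h
  refine ⟨U.symm, fun g x => ?_⟩
  rw [LinearIsometryEquiv.symm_apply_eq, hU, LinearIsometryEquiv.apply_symm_apply]

theorem IsIrreducible.unitarilyEquivalent_of_isometry [CompleteSpace E] [Nontrivial E]
    {π : UnitaryRep G E} {ρ : UnitaryRep G F} (hρ : ρ.IsIrreducible) (V : E →ₗᵢ[ℂ] F)
    (hV : ∀ g x, V (π g x) = ρ g (V x)) : π.UnitarilyEquivalent ρ := by
  have hsurj : LinearMap.range V.toLinearMap = ⊤ := by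
    refine (hρ.2 (LinearMap.range V.toLinearMap) ?_ ?_).resolve_left fun h => ?_
    · exact V.isometry.isClosedEmbedding.isClosed_range
    · rintro g _ ⟨x, rfl⟩
      exact ⟨π g x, hV g x⟩
    · obtain ⟨x, hx⟩ := exists_ne (0 : E)
      have h₁ : V x ∈ LinearMap.range V.toLinearMap := ⟨x, rfl⟩
      rw [h, Submodule.mem_bot, map_eq_zero_iff V V.injective] at h₁
      exact hx h₁
  exact ⟨LinearIsometryEquiv.ofSurjective V (LinearMap.range_eq_top.mp hsurj), hV⟩

theorem adjoint_intertwines [CompleteSpace E] [CompleteSpace F] {π : UnitaryRep G E}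
    {ρ : UnitaryRep G F} (T : E →L[ℂ] F) (hT : ∀ g x, T (π g x) = ρ g (T x)) (g : G) (y : F) :
    T.adjoint (ρ g y) = π g (T.adjoint y) := by
  refine ext_inner_right ℂ fun x => ?_
  rw [ContinuousLinearMap.adjoint_inner_left, inner_rep_left, inner_rep_left,
    ContinuousLinearMap.adjoint_inner_left, hT]

/-- Schur's lemma: a non-zero intertwiner of finite-dimensional irreducible unitary
representations gives a unitary equivalence. -/
theorem IsIrreducible.unitarilyEquivalent_of_intertwiner [FiniteDimensional ℂ E]
    [FiniteDimensional ℂ F] [CompleteSpace E] [CompleteSpace F] {π : UnitaryRep G E}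
    {ρ : UnitaryRep G F} (hπ : π.IsIrreducible) (hρ : ρ.IsIrreducible) (T : E →L[ℂ] F)
    (hT : ∀ g x, T (π g x) = ρ g (T x)) {x₀ : E} (hx₀ : T x₀ ≠ 0) :
    π.UnitarilyEquivalent ρ := by
  obtain ⟨c, hc⟩ := hπ.exists_eq_smul_of_commute (T.adjoint ∘L T : E →L[ℂ] E) fun g x => by
    simpa [hT] using adjoint_intertwines T hT g (T x)
  have hnorm (x : E) : ‖T x‖ ^ 2 = c.re * ‖x‖ ^ 2 := by
    have h₁ : ⟪x, T.adjoint (T x)⟫_ℂ = c * (‖x‖ ^ 2 : ℝ) := by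
      have := hc x
      simp only [ContinuousLinearMap.coe_coe, ContinuousLinearMap.comp_apply] at this
      rw [this, inner_smul_right, inner_self_eq_norm_sq_to_K]
      simp
    rw [ContinuousLinearMap.adjoint_inner_right] at h₁
    have h₂ : (⟪T x, T x⟫_ℂ).re = ‖T x‖ ^ 2 := inner_self_eq_norm_sq (𝕜 := ℂ) _
    rw [← h₂, h₁, Complex.re_mul_ofReal]
  have hκ : 0 < c.re := by
    have h₁ : 0 < ‖T x₀‖ ^ 2 := by positivity
    rw [hnorm] at h₁
    exact pos_of_mul_pos_left h₁ (by positivity)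
  have := hπ.1
  obtain ⟨V, hV⟩ := exists_isometric_intertwiner (T : E →ₗ[ℂ] F) hT hκ hnorm
  exact hρ.unitarilyEquivalent_of_isometry V hV

end Intertwiners

/-! ### From weak equivalence to an isometric intertwiner -/

section WeakEquivalence

variable {G : Type u} [Group G]
variable {E : Type v} [NormedAddCommGroup E] [InnerProductSpace ℂ E]
variable {F : Type w} [NormedAddCommGroup F] [InnerProductSpace ℂ F]

/-- The closure of the pairs `(ρ(f), π(f))`. When `ρ` and `π` are weakly equivalent, it is the
graph of an isomorphism of `C*_ρ(G)` with `C*_π(G)`. -/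
def cstarGraph (ρ : UnitaryRep G E) (π : UnitaryRep G F) :
    Subalgebra ℂ ((E →L[ℂ] E) × (F →L[ℂ] F)) :=
  ((groupAlgebraHom ρ).prod (groupAlgebraHom π)).range.topologicalClosure

variable {ρ : UnitaryRep G E} {π : UnitaryRep G F}

theorem mem_cstarGraph {p : (E →L[ℂ] E) × (F →L[ℂ] F)} : p ∈ cstarGraph ρ π ↔
    p ∈ closure (Set.range fun a => (groupAlgebraHom ρ a, groupAlgebraHom π a)) := by
  rw [cstarGraph, ← SetLike.mem_coe, Subalgebra.topologicalClosure_coe, AlgHom.coe_range]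
  rfl

theorem groupAlgebraHom_mem_cstarGraph (a : MonoidAlgebra ℂ G) :
    (groupAlgebraHom ρ a, groupAlgebraHom π a) ∈ cstarGraph ρ π :=
  mem_cstarGraph.mpr (subset_closure ⟨a, rfl⟩)

theorem star_mem_cstarGraph [CompleteSpace E] [CompleteSpace F]
    {p : (E →L[ℂ] E) × (F →L[ℂ] F)} (hp : p ∈ cstarGraph ρ π) : star p ∈ cstarGraph ρ π := by
  rw [mem_cstarGraph] at hp ⊢
  refine map_mem_closure continuous_star hp ?_
  rintro _ ⟨a, rfl⟩
  obtain ⟨b, h₁, h₂⟩ := exists_groupAlgebraHom_eq_star ρ π a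
  exact ⟨b, Prod.ext h₁ h₂⟩

theorem WeaklyEquivalent.norm_eq (h : π.WeaklyEquivalent ρ) (a : MonoidAlgebra ℂ G) :
    ‖groupAlgebraHom π a‖ = ‖groupAlgebraHom ρ a‖ := le_antisymm (h.1 a) (h.2 a)

theorem WeaklyEquivalent.norm_eq_of_mem_cstarGraph (h : π.WeaklyEquivalent ρ)
    {p : (E →L[ℂ] E) × (F →L[ℂ] F)} (hp : p ∈ cstarGraph ρ π) : ‖p.2‖ = ‖p.1‖ := by
  rw [mem_cstarGraph] at hp
  have hc : IsClosed {p : (E →L[ℂ] E) × (F →L[ℂ] F) | ‖p.2‖ = ‖p.1‖} :=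
    isClosed_eq continuous_snd.norm continuous_fst.norm
  refine closure_minimal ?_ hc hp
  rintro _ ⟨a, rfl⟩
  exact h.norm_eq a

theorem WeaklyEquivalent.exists_mem_cstarGraph [CompleteSpace F] (h : π.WeaklyEquivalent ρ)
    {T : E →L[ℂ] E} (hT : T ∈ cstarSubalgebra ρ) : ∃ S, (T, S) ∈ cstarGraph ρ π := by
  rw [mem_cstarSubalgebra, cstar, mem_closure_iff_seq_limit] at hT
  obtain ⟨x, hx, hlim⟩ := hT
  choose a ha using hx
  obtain rfl : (fun n => groupAlgebraHom ρ (a n)) = x := funext ha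
  have hC : CauchySeq fun n => groupAlgebraHom π (a n) := by
    have := hlim.cauchySeq
    rw [Metric.cauchySeq_iff] at this ⊢
    simpa only [dist_eq_norm, ← map_sub, h.norm_eq] using this
  obtain ⟨S, hS⟩ := cauchySeq_tendsto_of_complete hC
  exact ⟨S, mem_cstarGraph.mpr (mem_closure_of_tendsto (hlim.prodMk_nhds hS)
    (Eventually.of_forall fun n => ⟨a n, rfl⟩))⟩

/-- If `Φ x` is the image of `|x⟩⟨e|` under the isomorphism of C*-algebras, then `Φ x* Φ x = ‖x‖² Φ
e`. Thus `x ↦ Φ x y` is an intertwiner multiplying norms by a constant, which is positive as soon as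
`Φ e y ≠ 0`. -/
theorem WeaklyEquivalent.exists_isometric_intertwiner [CompleteSpace E] [CompleteSpace F]
    [Nontrivial E] (h : π.WeaklyEquivalent ρ)
    (hρ : ∀ x y : E, InnerProductSpace.rankOne ℂ x y ∈ cstarSubalgebra ρ) :
    ∃ V : E →ₗᵢ[ℂ] F, ∀ g x, V (ρ g x) = π g (V x) := by
  obtain ⟨e, he⟩ := exists_norm_eq E zero_le_one
  have huniq {T : E →L[ℂ] E} {S S' : F →L[ℂ] F} (hS : (T, S) ∈ cstarGraph ρ π)
      (hS' : (T, S') ∈ cstarGraph ρ π) : S = S' := by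
    have := h.norm_eq_of_mem_cstarGraph (sub_mem hS hS')
    simpa [sub_eq_zero] using this
  choose Φ hΦ using fun x => h.exists_mem_cstarGraph (hρ x e)
  have hadd (x y : E) : Φ (x + y) = Φ x + Φ y :=
    huniq (hΦ _) (by simpa using add_mem (hΦ x) (hΦ y))
  have hsmul (c : ℂ) (x : E) : Φ (c • x) = c • Φ x :=
    huniq (hΦ _) (by simpa using Subalgebra.smul_mem _ (hΦ x) c)
  have hmul (g : G) (x : E) : Φ (ρ g x) = toOperators π g * Φ x := by
    refine huniq (hΦ _) ?_
    have := mul_mem (groupAlgebraHom_mem_cstarGraph (ρ := ρ) (π := π) (MonoidAlgebra.single g 1))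
      (hΦ x)
    rw [Prod.mk_mul_mk, groupAlgebraHom_single, groupAlgebraHom_single, one_smul, one_smul,
      ContinuousLinearMap.mul_def, InnerProductSpace.comp_rankOne] at this
    exact this
  have hstar (x : E) : star (Φ x) * Φ x = ((‖x‖ ^ 2 : ℝ) : ℂ) • Φ e := by
    refine huniq (T := ((‖x‖ ^ 2 : ℝ) : ℂ) • InnerProductSpace.rankOne ℂ e e) ?_
      (Subalgebra.smul_mem _ (hΦ e) _)
    have := mul_mem (star_mem_cstarGraph (hΦ x)) (hΦ x)
    have h₁ : star (InnerProductSpace.rankOne ℂ x e) * InnerProductSpace.rankOne ℂ x e =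
        ((‖x‖ ^ 2 : ℝ) : ℂ) • InnerProductSpace.rankOne ℂ e e := by
      refine ContinuousLinearMap.ext fun z => ext_inner_left ℂ fun y => ?_
      rw [mul_apply_eq_comp, ContinuousLinearMap.star_eq_adjoint,
        ContinuousLinearMap.adjoint_inner_right]
      simp [inner_smul_left, inner_smul_right, inner_self_eq_norm_sq_to_K]
      ring
    rw [← h₁]
    exact this
  have hΦe : Φ e ≠ 0 := fun h0 => by
    have := h.norm_eq_of_mem_cstarGraph (hΦ e)
    simp [h0, he] at this
  obtain ⟨y, hy⟩ : ∃ y, Φ e y ≠ 0 := by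
    by_contra! hcon
    exact hΦe (ContinuousLinearMap.ext hcon)
  have hnorm (x : E) : ‖Φ x y‖ ^ 2 = (⟪y, Φ e y⟫_ℂ).re * ‖x‖ ^ 2 := by
    have h₁ : ⟪Φ x y, Φ x y⟫_ℂ = ((‖x‖ ^ 2 : ℝ) : ℂ) * ⟪y, Φ e y⟫_ℂ := by
      rw [← inner_smul_right, ← smul_apply, ← hstar, mul_apply_eq_comp,
        ContinuousLinearMap.star_eq_adjoint, ContinuousLinearMap.adjoint_inner_right]
    have h₂ : (⟪Φ x y, Φ x y⟫_ℂ).re = ‖Φ x y‖ ^ 2 := inner_self_eq_norm_sq (𝕜 := ℂ) _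
    rw [← h₂, h₁, Complex.re_ofReal_mul, mul_comm]
  let T : E →ₗ[ℂ] F :=
    { toFun := fun x => Φ x y
      map_add' := fun a b => by rw [hadd, add_apply]
      map_smul' := fun c a => by rw [hsmul, smul_apply, RingHom.id_apply] }
  refine UnitaryRep.exists_isometric_intertwiner (π := ρ) (ρ := π) T (fun g x => ?_) ?_ hnorm
  · change Φ (ρ g x) y = π g (Φ x y)
    rw [hmul]
    rfl
  · have h₁ : 0 < ‖Φ e y‖ ^ 2 := by positivity
    rw [hnorm] at h₁
    exact pos_of_mul_pos_left h₁ (by positivity)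

end WeakEquivalence

open scoped Pointwise

/-! ### Finite orbits and commensurators -/

section Commensurability

variable {G : Type u} [Group G]

theorem mem_conjSubgroup {L : Subgroup G} {g x : G} : x ∈ conjSubgroup L g ↔ g * x * g⁻¹ ∈ L :=
  Iff.rfl

theorem toConjAct_smul_eq (L : Subgroup G) (g : G) :
    ConjAct.toConjAct g • L = conjSubgroup L g⁻¹ := by
  ext x
  rw [Subgroup.mem_pointwise_smul_iff_inv_smul_mem, mem_conjSubgroup, ← ConjAct.toConjAct_inv,
    ConjAct.toConjAct_smul]

theorem stabilizer_coset (Γ L : Subgroup G) (g : G) :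
    MulAction.stabilizer Γ (g : G ⧸ L) = (conjSubgroup L g⁻¹).subgroupOf Γ := by
  ext x
  rw [MulAction.mem_stabilizer_iff, Subgroup.mem_subgroupOf, mem_conjSubgroup, eq_comm]
  change ((g : G ⧸ L) = ((x : G) * g : G)) ↔ _
  rw [QuotientGroup.eq, inv_inv, mul_assoc]

theorem relIndex_conjSubgroup (Γ L : Subgroup G) (g : G) :
    (conjSubgroup L g⁻¹).relIndex Γ = (MulAction.orbit Γ (g : G ⧸ L)).ncard := by
  rw [Subgroup.relIndex, ← stabilizer_coset, MulAction.index_stabilizer]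

theorem relIndex_conjSubgroup_ne_zero_iff (Γ L : Subgroup G) (g : G) :
    (conjSubgroup L g⁻¹).relIndex Γ ≠ 0 ↔ (MulAction.orbit Γ (g : G ⧸ L)).Finite := by
  rw [relIndex_conjSubgroup]
  constructor
  · exact Set.finite_of_ncard_ne_zero
  · exact fun h => ((Set.ncard_pos h).mpr ⟨_, MulAction.mem_orbit_self _⟩).ne'

/-- A finite-dimensional `Γ`-invariant family of vectors of an induced representation lives on
finite `Γ`-orbits. -/
theorem relIndex_conjSubgroup_ne_zero_of_intertwiner {Γ L : Subgroup G}
    {M : Type w} [NormedAddCommGroup M] [InnerProductSpace ℂ M] [FiniteDimensional ℂ M]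
    {K : Type v} [NormedAddCommGroup K] [InnerProductSpace ℂ K] {σ : UnitaryRep L K}
    (τ : UnitaryRep Γ M) (T : M →L[ℂ] InducedSpace σ)
    (hT : ∀ (x : Γ) m, T (τ x m) = induced σ (x : G) (T m)) {g : G} {m : M} (hm : T m g ≠ 0) :
    (conjSubgroup L g⁻¹).relIndex Γ ≠ 0 := by
  rw [relIndex_conjSubgroup_ne_zero_iff]
  set c := InducedSpace.sliceNorm T g with hc
  have hc0 : 0 < c := by
    refine (InducedSpace.sliceNorm_nonneg T g).lt_of_ne fun h0 => hm ?_
    have := InducedSpace.norm_apply_le_sliceNorm T g m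
    rw [← h0, zero_mul] at this
    exact norm_le_zero_iff.mp this
  have hinv (x : Γ) (y : G) :
      InducedSpace.sliceNorm T ((x : G) * y) = InducedSpace.sliceNorm T y := by
    have h₁ : toOperators (induced σ) ((x⁻¹ : Γ) : G) ∘L T =
        T ∘L ((τ x⁻¹).toContinuousLinearEquiv : M →L[ℂ] M) := by
      ext1 m
      exact (hT x⁻¹ m).symm
    have h₂ := InducedSpace.sliceNorm_comp_induced T ((x⁻¹ : Γ) : G) y
    rw [h₁, InducedSpace.sliceNorm_comp_isometry] at h₂
    rw [h₂, InvMemClass.coe_inv, inv_inv]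
  -- A square summable function has finite superlevel sets at positive heights; invariance puts the
  -- whole orbit of `gL` in one of them.
  have hfin : {q : G ⧸ L | c ^ 2 ≤ InducedSpace.sliceNorm T q.out ^ 2}.Finite := by
    have h₁ := (InducedSpace.summable_sliceNorm_sq T).tendsto_cofinite_zero
    have h₂ := h₁.eventually (gt_mem_nhds (show (0 : ℝ) < c ^ 2 by positivity))
    rw [Filter.eventually_cofinite] at h₂
    simpa only [not_lt] using h₂
  refine hfin.subset ?_
  rintro _ ⟨x, rfl⟩
  have h₁ : InducedSpace.sliceNorm T (x • (g : G ⧸ L)).out = c := by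
    rw [hc, ← hinv x g]
    apply InducedSpace.sliceNorm_congr
    rw [QuotientGroup.out_eq']
    rfl
  change c ^ 2 ≤ InducedSpace.sliceNorm T (x • (g : G ⧸ L)).out ^ 2
  rw [h₁]

/-- An action with a spectral gap has no finite orbits. -/
theorem HasSpectralGap.infinite_orbit {X : Type v} [MulAction G X] (h : HasSpectralGap G X)
    (x : X) : (MulAction.orbit G x).Infinite := by
  intro hfin
  obtain ⟨S, ε, hε, hS⟩ := h.exists_le_sum
  -- The indicator of a finite orbit would be a non-zero invariant vector.
  let f : X → ℂ := (MulAction.orbit G x).indicator 1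
  have hf : Memℓp f 2 := by
    rw [memℓp_gen_iff (by norm_num)]
    refine summable_of_hasFiniteSupport (hfin.subset fun y hy => ?_)
    by_contra hne
    simp [f, Set.indicator_of_notMem hne] at hy
  let ξ : lp (fun _ : X => ℂ) 2 := ⟨f, hf⟩
  have hinv (s : G) : permutation G X s ξ - ξ = 0 := by
    rw [sub_eq_zero]
    ext y
    rw [permutation_apply]
    change (MulAction.orbit G x).indicator 1 (s⁻¹ • y) = (MulAction.orbit G x).indicator 1 y
    by_cases hy : y ∈ MulAction.orbit G x
    · rw [Set.indicator_of_mem hy,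
        Set.indicator_of_mem (MulAction.mem_orbit_of_mem_orbit s⁻¹ hy)]
      rfl
    · have hy' : s⁻¹ • y ∉ MulAction.orbit G x := fun hh => hy <| by
        simpa using MulAction.mem_orbit_of_mem_orbit s hh
      rw [Set.indicator_of_notMem hy, Set.indicator_of_notMem hy']
  have h₁ := hS ξ
  simp only [hinv, norm_zero, ne_eq, OfNat.ofNat_ne_zero, not_false_eq_true, zero_pow,
    Finset.sum_const_zero] at h₁
  have hξ : ξ ≠ 0 := fun h0 => by
    have h₂ : f x = 0 := congrArg (fun η : lp (fun _ : X => ℂ) 2 => η x) h0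
    simp [f] at h₂
  have : 0 < ε * ‖ξ‖ ^ 2 := by positivity
  linarith

/-- An element of the commensurator outside `H` gives a coset other than `H` with finite `H`-orbit,
against the gap. -/
theorem HasSpectralGapProperty.isSelfCommensurating {H : Subgroup G}
    (hH : HasSpectralGapProperty H) : IsSelfCommensurating H := by
  apply le_antisymm
  · intro g hg
    by_contra hgH
    rw [Subgroup.Commensurable.commensurator_mem_iff, toConjAct_smul_eq] at hg
    have hfin := (relIndex_conjSubgroup_ne_zero_iff H H g).mp hg.1
    have hq : (g : G ⧸ H) ∈ cosetsAwayFromBase H := fun h => hgH <| by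
      have h' : ((1 : G) : G ⧸ H) = g := Eq.symm h
      rw [QuotientGroup.eq] at h'
      simpa using h'
    refine HasSpectralGap.infinite_orbit hH ⟨_, hq⟩ ?_
    refine Set.Finite.of_finite_image (f := Subtype.val) (hfin.subset ?_)
      Subtype.val_injective.injOn
    rintro _ ⟨_, ⟨x, rfl⟩, rfl⟩
    exact ⟨x, rfl⟩
  · intro g hg
    rw [Subgroup.Commensurable.commensurator_mem_iff, toConjAct_smul_eq]
    have : conjSubgroup H g⁻¹ = H := by
      ext x
      rw [mem_conjSubgroup, inv_inv, H.mul_mem_cancel_right hg,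
        H.mul_mem_cancel_left (H.inv_mem hg)]
    rw [this]

theorem IsSelfCommensurating.conj {L : Subgroup G} (hL : IsSelfCommensurating L) (g : G) :
    IsSelfCommensurating (conjSubgroup L g⁻¹) := by
  ext x
  rw [Subgroup.Commensurable.commensurator_mem_iff, ← toConjAct_smul_eq,
    Subgroup.Commensurable.commensurable_conj (ConjAct.toConjAct g)⁻¹, inv_smul_smul, ← mul_smul,
    ← mul_smul, ← ConjAct.toConjAct_inv, ← ConjAct.toConjAct_mul, ← ConjAct.toConjAct_mul,
    ← Subgroup.Commensurable.commensurator_mem_iff, hL, toConjAct_smul_eq, mem_conjSubgroup,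
    inv_inv, mul_assoc]

/-- Commensurable subgroups have the same commensurator. -/
theorem IsSelfCommensurating.eq_of_commensurable {H L : Subgroup G} (hH : IsSelfCommensurating H)
    (hL : IsSelfCommensurating L) (h : H.Commensurable L) : H = L := by
  rw [← hH, h.eq, hL]

end Commensurability

/-! ### Irreducibility of conjugate representations -/

section Conjugation

variable {G : Type u} [Group G] {H L : Subgroup G}
variable {M : Type w} [NormedAddCommGroup M] [InnerProductSpace ℂ M]

theorem IsIrreducible.conjRep_comp_inclusion {σ : UnitaryRep L M} (hσ : σ.IsIrreducible) {g : G}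
    (hg : H = conjSubgroup L g) :
    IsIrreducible ((conjRep σ g).comp (Subgroup.inclusion hg.le) : UnitaryRep H M) := by
  refine ⟨hσ.1, fun S hS hinv => hσ.2 S hS fun l m hm => ?_⟩
  have hx : g⁻¹ * l * g ∈ H := by
    rw [hg, mem_conjSubgroup]
    simp [mul_assoc]
  have := hinv ⟨_, hx⟩ m hm
  have h₁ : ((conjRep σ g).comp (Subgroup.inclusion hg.le) : UnitaryRep H M) ⟨_, hx⟩ = σ l := by
    change σ _ = σ l
    congr 1
    ext
    change g * (g⁻¹ * l * g) * g⁻¹ = l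
    simp [mul_assoc]
  rwa [h₁] at this

end Conjugation

/-! ### Recovering the inducing subgroup and representation -/

section Rigidity

open InducedSpace

variable {G : Type u} [Group G] {H L : Subgroup G}
variable {K : Type v} [NormedAddCommGroup K] [InnerProductSpace ℂ K] [CompleteSpace K]
  [FiniteDimensional ℂ K]
variable {M : Type w} [NormedAddCommGroup M] [InnerProductSpace ℂ M] [CompleteSpace M]
  [FiniteDimensional ℂ M]

/-- An isometric intertwiner of representations induced from finite-dimensional representations
of self-commensurating subgroups comes from a conjugation. -/
theorem exists_conj_of_intertwiner (hH : IsSelfCommensurating H) (hL : IsSelfCommensurating L)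
    {π : UnitaryRep H K} {σ : UnitaryRep L M} (hπ : π.IsIrreducible) (hσ : σ.IsIrreducible)
    (V : InducedSpace π →ₗᵢ[ℂ] InducedSpace σ)
    (hV : ∀ g f, V (induced π g f) = induced σ g (V f)) :
    ∃ (g : G) (hg : H = conjSubgroup L g),
      π.UnitarilyEquivalent ((conjRep σ g).comp (Subgroup.inclusion hg.le)) := by
  let W : InducedSpace π →L[ℂ] InducedSpace σ := V.toContinuousLinearMap
  have hW (g : G) (f) : W (induced π g f) = induced σ g (W f) := hV g f
  have := hπ.1
  obtain ⟨k, hk⟩ := exists_ne (0 : K)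
  obtain ⟨g, hg⟩ : ∃ g, W (inclCLM π k) g ≠ 0 := by
    by_contra! hcon
    have h₁ : W (inclCLM π k) = 0 := InducedSpace.ext hcon
    have h₂ : ‖W (inclCLM π k)‖ = ‖k‖ := (V.norm_map _).trans (norm_inclCLM k)
    rw [h₁, norm_zero] at h₂
    exact hk (norm_eq_zero.mp h₂.symm)
  have hindex₁ : (conjSubgroup L g⁻¹).relIndex H ≠ 0 :=
    relIndex_conjSubgroup_ne_zero_of_intertwiner π (W ∘L inclCLM π) (fun h k => by
      change W (inclCLM π (π h k)) = induced σ (h : G) (W (inclCLM π k))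
      rw [inclCLM_rep, hW]) hg
  have hindex₂ : H.relIndex (conjSubgroup L g⁻¹) ≠ 0 := by
    -- This lets the finite-orbit argument apply at the base coset of `G/H`.
    have h₁ : H = conjSubgroup H (1 : G)⁻¹ := by
      ext x
      simp [mem_conjSubgroup]
    rw [h₁]
    -- The translate of `M` by `g` is invariant under `gLg⁻¹`, and the adjoint carries it to vectors
    -- induced from `H`. Pairing with `inclCLM π k` shows that `T m` does not vanish at `1` for `m =
    -- W (inclCLM π k) g`.
    let T : M →L[ℂ] InducedSpace π := W.adjoint ∘L toOperators (induced σ) g ∘L inclCLM σ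
    have hT (m : M) : T m = W.adjoint (induced σ g (inclCLM σ m)) := rfl
    refine relIndex_conjSubgroup_ne_zero_of_intertwiner (conjRep σ g⁻¹) T
      (m := W (inclCLM π k) g) (fun x m => ?_) fun h0 => hg ?_
    · rw [hT, hT, ← adjoint_intertwines W hW]
      congr 1
      change induced σ g (inclCLM σ (σ ⟨g⁻¹ * x * g⁻¹⁻¹, x.2⟩ m)) = _
      rw [inclCLM_rep]
      ext y
      simp only [induced_apply]
      congr 1
      simp [mul_assoc]
    · have h₂ : ⟪inclCLM π k, T (W (inclCLM π k) g)⟫_ℂ = 0 := by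
        rw [inner_inclCLM_left, h0, inner_zero_right]
      rw [hT, ContinuousLinearMap.adjoint_inner_right, ← inner_conj_symm,
        inner_induced_inclCLM_left] at h₂
      simpa using h₂
  have hHL : H = conjSubgroup L g⁻¹ := hH.eq_of_commensurable (hL.conj g) ⟨hindex₂, hindex₁⟩
  -- The point where `W (inclCLM π k)` is non-zero enters inverted, since `conjSubgroup L g⁻¹` is
  -- `gLg⁻¹`. Evaluation at `g` intertwines `π` with the conjugate of `σ`, and Schur's lemma
  -- concludes.
  refine ⟨g⁻¹, hHL, hπ.unitarilyEquivalent_of_intertwiner (hσ.conjRep_comp_inclusion hHL)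
    (evalCLM σ g ∘L W ∘L inclCLM π) (fun h k => ?_) hg⟩
  have hl : g⁻¹ * h * g⁻¹⁻¹ ∈ L := mem_conjSubgroup.mp (hHL ▸ h.2)
  change W (inclCLM π (π h k)) g = σ ⟨g⁻¹ * h * g⁻¹⁻¹, hl⟩ (W (inclCLM π k) g)
  have h₁ := (W (inclCLM π k)).apply_mul g ⟨g⁻¹ * h * g⁻¹⁻¹, hl⟩⁻¹
  rw [inv_inv (⟨g⁻¹ * h * g⁻¹⁻¹, hl⟩ : L)] at h₁
  rw [inclCLM_rep, hW, induced_apply, ← h₁]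
  congr 1
  simp [mul_assoc]

end Rigidity

end UnitaryRep

theorem mainTheorem1 {G : Type u} [Group G] [Countable G] (H : Subgroup G)
    (hH : UnitaryRep.HasSpectralGapProperty H) :
    (∀ (K : Type v) [NormedAddCommGroup K] [InnerProductSpace ℂ K] [CompleteSpace K]
        [FiniteDimensional ℂ K] (σ : UnitaryRep H K), σ.IsIrreducible →
        (UnitaryRep.induced σ).IsIrreducible ∧ (UnitaryRep.induced σ).IsTraceable ∧
          (UnitaryRep.induced σ).ContainsCompacts) ∧
    (∀ (K : Type v) [NormedAddCommGroup K] [InnerProductSpace ℂ K] [CompleteSpace K]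
        [FiniteDimensional ℂ K] (σ : UnitaryRep H K)
        (E : Type w) [NormedAddCommGroup E] [InnerProductSpace ℂ E] [CompleteSpace E]
        (π : UnitaryRep G E), σ.IsIrreducible → π.IsIrreducible →
        π.WeaklyEquivalent (UnitaryRep.induced σ) →
        π.UnitarilyEquivalent (UnitaryRep.induced σ)) ∧
    (∀ (L : Subgroup G), UnitaryRep.IsSelfCommensurating L →
      ∀ (K : Type v) [NormedAddCommGroup K] [InnerProductSpace ℂ K] [CompleteSpace K]
        [FiniteDimensional ℂ K] (π : UnitaryRep H K)
        (M : Type w) [NormedAddCommGroup M] [InnerProductSpace ℂ M] [CompleteSpace M]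
        [FiniteDimensional ℂ M] (σ : UnitaryRep L M), π.IsIrreducible → σ.IsIrreducible →
        (UnitaryRep.induced σ).WeaklyEquivalent (UnitaryRep.induced π) →
        ∃ (g : G) (hg : H = UnitaryRep.conjSubgroup L g),
          π.UnitarilyEquivalent ((UnitaryRep.conjRep σ g).comp (Subgroup.inclusion hg.le))) := by
  refine ⟨?_, ?_, ?_⟩
  · intro K _ _ _ _ σ hσ
    have hirr := hσ.induced hH
    have := hirr.1
    have hrank := UnitaryRep.rankOne_mem_cstar hH hσ
    exact ⟨hirr, UnitaryRep.isTraceable_of_rankOne_mem hrank,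
      UnitaryRep.containsCompacts_of_rankOne_mem hrank⟩
  · intro K _ _ _ _ σ E _ _ _ π hσ hπ hw
    have := (hσ.induced hH).1
    obtain ⟨V, hV⟩ := hw.exists_isometric_intertwiner (UnitaryRep.rankOne_mem_cstar hH hσ)
    exact (hπ.unitarilyEquivalent_of_isometry V hV).symm
  · intro L hL K _ _ _ _ π M _ _ _ _ σ hπ hσ hw
    have := (hπ.induced hH).1
    -- Only the side induced from `H` is known to have compact operators in its C*-algebra, so `V`
    -- starts there; it need not be onto.
    obtain ⟨V, hV⟩ := hw.exists_isometric_intertwiner (UnitaryRep.rankOne_mem_cstar hH hπ)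
    exact UnitaryRep.exists_conj_of_intertwiner hH.isSelfCommensurating hL hπ hσ V hV

end
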